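/- **Setting.** Let $d\ge 2$, let $\Omega\subset\mathbb R^d$ be a bounded domain with piecewise smooth boundary (the boundary is locally flattened by bi-Lipschitz coordinates and is a smooth hypersurface outside a set of zero surface measure), let $T>0$, $Q=\Omega\times(0,T)$, and let $\nu$ be the outward unit normal. Write $[s]$ for the integer part of $s$. Let $a,c\in C^{[(d+1)/2]+3}(\mathbb R^d)$ and $B\in C^{[(d+1)/2]+3}(\mathbb R^d,\mathbb R^d)$ be such that $c-1$, $a$, $B$ are compactly supported, and let $f\in H^{[(d+1)/2]+5}(\mathbb R^d)$ have compact support. Let $h:\mathbb R^d\times[0,\infty)\to\mathbb R$ satisfy $h(\cdot,t)\in C^{[(d+1)/2]+1}(\mathbb R^d)$ for all $t>0$ and $h(x,\cdot)\in C^3([0,\infty))$ for all $x$, with $h_{tt}$ bounded on $Q$. Let $\tilde h$ be $C^2$ on $\overline\Omega\times[0,T]$ (up to the boundary) and nowhere zero there, with $\tilde h(x,0)=h(x,0)$ and $\tilde h_t(x,0)=h_t(x,0)$ for $x\in\Omega$. For $\phi\in H^3(Q)$ put $$\mathcal L\phi=c\,\phi_{tt}-\Delta\phi-L(\phi,\nabla\phi,\phi_t)+\frac{c\,h_{tt}}{\tilde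 h}\int_0^t\phi_t(x,\tau)\,d\tau,$$ $$L(\phi,\nabla\phi,\phi_t)=\frac{a\tilde h\phi+B\cdot\nabla(\tilde h\phi)}{\tilde h}+c\Big(\big(\tfrac1{\tilde h}\big)_{tt}\tilde h+\frac{h_{tt}}{\tilde h}\Big)\phi+2c\big(\tfrac1{\tilde h}\big)_t(\tilde h\phi)_t-\Delta\big(\tfrac1{\tilde h}\big)\tilde h\phi-2\nabla\big(\tfrac1{\tilde h}\big)\cdot\nabla(\tilde h\phi),$$ and let $$\mathcal F(x,t)=-\frac{h_{tt}(x,t)\,\big(\Delta f(x)+a(x)f(x)+B(x)\cdot\nabla f(x)\big)}{h(x,0)\,\tilde h(x,t)}.$$ Given functions $\Psi$ on $\Omega$ and $\zeta,\xi$ on $\partial\Omega\times(0,T)$, let $$K=\big\{\phi\in H^3(Q):\ \phi_t(\cdot,0)=\Psi\text{ on }\Omega,\ \ \phi=\zeta\text{ and }\partial_\nu\phi=\xi\text{ on }\partial\Omega\times(0,T)\big\},$$ where the boundary values are $L^2$ traces, and assume that $K$ is non-empty. **Proposition.** For each $\alpha>0$ the functional $$\mathcal J_\alpha(w)=\|\mathcal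 Lw-\mathcal F\|^2_{L^2(Q)}+\alpha\|w\|^2_{H^3(Q)},\qquad \|w\|^2_{H^3(Q)}=\sum_{|\beta|\le3}\|\partial^\beta w\|^2_{L^2(Q)},$$ is finite on $K$ and has a unique minimizer $w_\alpha$ in $K$. -/

import Mathlib

open MeasureTheory Set Filter Topology
open scoped ContDiff ENNReal

noncomputable section

/-! ### Weak derivatives and Sobolev spaces `H^k(U)`

`b : Fin n → V` is a coordinate frame of the space `V`, `U` an open subset of `V`. -/

section Sobolev

variable {V : Type*} [NormedAddCommGroup V] [NormedSpace ℝ V] [MeasureSpace V] {n : ℕ}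

/-- The classical partial derivative `∂^α φ` of a smooth function, for a multi-index `α`. -/
def partialDeriv (b : Fin n → V) (α : Fin n → ℕ) (φ : V → ℝ) : V → ℝ :=
  (List.finRange n).foldr
    (fun i g => (fun (u : V → ℝ) (x : V) => fderiv ℝ u x (b i))^[α i] g) φ

/-- `v` is the weak derivative `∂^α u` in `U`:
`∫_U u ∂^α φ = (-1)^|α| ∫_U v φ` for all test functions `φ ∈ C_c^∞(U)`. -/
def IsWeakDeriv (b : Fin n → V) (α : Fin n → ℕ) (U : Set V) (u v : V → ℝ) : Prop :=
  ∀ φ : V → ℝ, ContDiff ℝ ∞ φ → HasCompactSupport φ → tsupport φ ⊆ U →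
    ∫ x in U, u x * partialDeriv b α φ x = (-1) ^ (∑ i, α i) * ∫ x in U, v x * φ x

/-- `u ∈ H^k(U)`: `u` and all its weak derivatives of order at most `k` are in `L²(U)`. -/
def MemHk (b : Fin n → V) (k : ℕ) (U : Set V) (u : V → ℝ) : Prop :=
  MemLp u 2 (volume.restrict U) ∧
    ∀ α : Fin n → ℕ, ∑ i, α i ≤ k →
      ∃ v : V → ℝ, MemLp v 2 (volume.restrict U) ∧ IsWeakDeriv b α U u v

open Classical in
/-- The (almost everywhere unique) weak derivative `∂^α u ∈ L²(U)`, if there is one. -/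
def weakDeriv (b : Fin n → V) (α : Fin n → ℕ) (U : Set V) (u : V → ℝ) : V → ℝ :=
  if h : ∃ v : V → ℝ, MemLp v 2 (volume.restrict U) ∧ IsWeakDeriv b α U u v
  then Classical.choose h else 0

/-- The multi-indices of order at most `k`. -/
def multiIndices (n k : ℕ) : Finset (Fin n → ℕ) :=
  (Fintype.piFinset fun _ : Fin n => Finset.range (k + 1)).filter fun α => ∑ i, α i ≤ k

/-- `‖u‖²_{H^k(U)} = ∑_{|α| ≤ k} ‖∂^α u‖²_{L²(U)}`, for `u ∈ H^k(U)`. -/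
def hkNormSq (b : Fin n → V) (k : ℕ) (U : Set V) (u : V → ℝ) : ℝ≥0∞ :=
  ∑ α ∈ multiIndices n k, eLpNorm (weakDeriv b α U u) 2 (volume.restrict U) ^ 2

/-- Traces. `𝓑` is a boundary operator defined classically on smooth functions (restriction,
or a first derivative), and `σ` is the surface measure of a part of the boundary of `U`.
Its extension by density to `H^k(U)` sends `u` to `z ∈ L²(σ)`: there are functions `φ j`, smooth
up to the boundary, with `φ j → u` in `H^k(U)` and `𝓑 (φ j) → z` in `L²(σ)`. -/
def HasTrace (b : Fin n → V) (k : ℕ) (U : Set V) (σ : Measure V)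
    (𝓑 : (V → ℝ) → V → ℝ) (u z : V → ℝ) : Prop :=
  MemLp z 2 σ ∧ ∃ φ : ℕ → V → ℝ,
    (∀ j, ContDiff ℝ ∞ (φ j)) ∧ (∀ j, MemLp (𝓑 (φ j)) 2 σ) ∧
    (∀ α : Fin n → ℕ, ∑ i, α i ≤ k →
      Tendsto (fun j => eLpNorm (fun x => partialDeriv b α (φ j) x - weakDeriv b α U u x) 2
        (volume.restrict U)) atTop (𝓝 0)) ∧
    Tendsto (fun j => eLpNorm (fun x => 𝓑 (φ j) x - z x) 2 σ) atTop (𝓝 0)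

end Sobolev

section Domain

variable {d : ℕ}

/-- `ν` is the outward unit normal of `Ω` at the smooth boundary point `x`: near `x`, the set `Ω`
is `{ρ < 0}` for a smooth function `ρ` with `ρ x = 0` and `∇ρ x ≠ 0`, and `ν = ∇ρ x / |∇ρ x|`. -/
def IsOuterNormal (Ω : Set (EuclideanSpace ℝ (Fin d))) (x ν : EuclideanSpace ℝ (Fin d)) : Prop :=
  ∃ (W : Set (EuclideanSpace ℝ (Fin d))) (ρ : EuclideanSpace ℝ (Fin d) → ℝ),
    IsOpen W ∧ x ∈ W ∧ ContDiffOn ℝ ∞ ρ W ∧ ρ x = 0 ∧ gradient ρ x ≠ 0 ∧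
    (∀ y ∈ W, y ∈ Ω ↔ ρ y < 0) ∧ ν = ‖gradient ρ x‖⁻¹ • gradient ρ x

open Classical in
/-- The outward unit normal field, defined at the smooth boundary points. -/
def outerNormal (Ω : Set (EuclideanSpace ℝ (Fin d))) (x : EuclideanSpace ℝ (Fin d)) :
    EuclideanSpace ℝ (Fin d) :=
  if h : ∃ ν, IsOuterNormal Ω x ν then Classical.choose h else 0

/-- A bounded domain with piecewise smooth boundary: the boundary is Lipschitz (near each boundary
point, `Ω` is a half space in suitable bi-Lipschitz coordinates), and it is a smooth
hypersurface except on a set of surface measure zero (edges, corners). -/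
structure IsPiecewiseSmoothDomain (Ω : Set (EuclideanSpace ℝ (Fin d))) : Prop where
  isOpen : IsOpen Ω
  isConnected : IsConnected Ω
  isBounded : Bornology.IsBounded Ω
  lipschitz : ∀ x ∈ frontier Ω,
    ∃ (Φ : OpenPartialHomeomorph (EuclideanSpace ℝ (Fin d)) (EuclideanSpace ℝ (Fin d)))
      (C : NNReal) (e : EuclideanSpace ℝ (Fin d)),
      x ∈ Φ.source ∧ LipschitzOnWith C Φ Φ.source ∧ LipschitzOnWith C Φ.symm Φ.target ∧
      e ≠ 0 ∧ ∀ y ∈ Φ.source, y ∈ Ω ↔ 0 < inner ℝ e (Φ y)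
  smooth : Measure.hausdorffMeasure ((d : ℝ) - 1)
    {x ∈ frontier Ω | ¬ ∃ ν, IsOuterNormal Ω x ν} = 0

/-- The coordinate frame `e₁, …, e_d` of `ℝ^d`. -/
def spaceFrame (d : ℕ) (i : Fin d) : EuclideanSpace ℝ (Fin d) := EuclideanSpace.single i 1

/-- The coordinate frame of space-time `ℝ^d × ℝ`: first the space directions, time is last. -/
def spaceTimeFrame (d : ℕ) : Fin (d + 1) → EuclideanSpace ℝ (Fin d) × ℝ :=
  Fin.snoc (α := fun _ => EuclideanSpace ℝ (Fin d) × ℝ)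
    (fun i : Fin d => ((spaceFrame d i, 0) : EuclideanSpace ℝ (Fin d) × ℝ)) (0, 1)

/-- The space-time cylinder `Ω × (0, T)`. -/
def cylinder (Ω : Set (EuclideanSpace ℝ (Fin d))) (T : ℝ) : Set (EuclideanSpace ℝ (Fin d) × ℝ) :=
  Ω ×ˢ Ioo 0 T

/-- Surface measure on the lateral boundary `∂Ω × (0, T)` (up to the constant normalization factor
of the Hausdorff measure). -/
def lateralMeasure (Ω : Set (EuclideanSpace ℝ (Fin d))) (T : ℝ) :
    Measure (EuclideanSpace ℝ (Fin d) × ℝ) :=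
  ((Measure.hausdorffMeasure ((d : ℝ) - 1)).restrict (frontier Ω)).prod
    (volume.restrict (Ioo 0 T))

/-- Lebesgue measure on the initial time slice `Ω × {0}`. -/
def initialMeasure (Ω : Set (EuclideanSpace ℝ (Fin d))) : Measure (EuclideanSpace ℝ (Fin d) × ℝ) :=
  (volume.restrict Ω).prod (Measure.dirac 0)

/-- `L²(Ω × (0, T))`. -/
abbrev SpaceTimeL2 (Ω : Set (EuclideanSpace ℝ (Fin d))) (T : ℝ) : Type :=
  Lp ℝ 2 (volume.restrict (cylinder Ω T))

/-- The constraint set `K`: all `φ ∈ H³(Ω × (0, T))` with `φ_t(x, 0) = Ψ(x)` for `x ∈ Ω`, and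
`φ = ζ`, `∂_ν φ = ξ` on `∂Ω × (0, T)`, in the sense of traces. -/
def constraintSet (Ω : Set (EuclideanSpace ℝ (Fin d))) (T : ℝ)
    (Ψ : EuclideanSpace ℝ (Fin d) → ℝ) (ζ ξ : EuclideanSpace ℝ (Fin d) × ℝ → ℝ) :
    Set (SpaceTimeL2 Ω T) :=
  {w | MemHk (spaceTimeFrame d) 3 (cylinder Ω T) w ∧
    HasTrace (spaceTimeFrame d) 2 (cylinder Ω T) (initialMeasure Ω)
      (fun φ p => fderiv ℝ φ p (0, 1)) w (fun p => Ψ p.1) ∧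
    HasTrace (spaceTimeFrame d) 1 (cylinder Ω T) (lateralMeasure Ω T) (fun φ => φ) w ζ ∧
    HasTrace (spaceTimeFrame d) 2 (cylinder Ω T) (lateralMeasure Ω T)
      (fun φ p => fderiv ℝ φ p (outerNormal Ω p.1, 0)) w ξ}

/-! ### The Volterra integro-differential operator -/

/-- The weak time derivative `w_t`. -/
def timeDeriv (Ω : Set (EuclideanSpace ℝ (Fin d))) (T : ℝ)
    (w : EuclideanSpace ℝ (Fin d) × ℝ → ℝ) : EuclideanSpace ℝ (Fin d) × ℝ → ℝ :=
  weakDeriv (spaceTimeFrame d) (Pi.single (Fin.last d) 1) (cylinder Ω T) w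

/-- The weak second time derivative `w_tt`. -/
def timeDeriv2 (Ω : Set (EuclideanSpace ℝ (Fin d))) (T : ℝ)
    (w : EuclideanSpace ℝ (Fin d) × ℝ → ℝ) : EuclideanSpace ℝ (Fin d) × ℝ → ℝ :=
  weakDeriv (spaceTimeFrame d) (Pi.single (Fin.last d) 2) (cylinder Ω T) w

/-- The weak spatial gradient `∇w`. -/
def spaceGrad (Ω : Set (EuclideanSpace ℝ (Fin d))) (T : ℝ)
    (w : EuclideanSpace ℝ (Fin d) × ℝ → ℝ) (p : EuclideanSpace ℝ (Fin d) × ℝ) :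
    EuclideanSpace ℝ (Fin d) :=
  WithLp.toLp 2 fun i =>
    weakDeriv (spaceTimeFrame d) (Pi.single (Fin.castSucc i) 1) (cylinder Ω T) w p

/-- The weak spatial Laplacian `Δw`. -/
def spaceLaplacian (Ω : Set (EuclideanSpace ℝ (Fin d))) (T : ℝ)
    (w : EuclideanSpace ℝ (Fin d) × ℝ → ℝ) (p : EuclideanSpace ℝ (Fin d) × ℝ) : ℝ :=
  ∑ i : Fin d,
    weakDeriv (spaceTimeFrame d) (Pi.single (Fin.castSucc i) 2) (cylinder Ω T) w p

/-- The lower order term `L(w, ∇w, w_t)` at the point `(x, t)`, as a function of the values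
`z = w`, `q = ∇w`, `r = w_t` there. Here `k` stands for `h̃`; by the product rule
`∇(h̃ w) = h̃ ∇w + w ∇h̃` and `(h̃ w)_t = h̃ w_t + h̃_t w`. -/
def lowerOrder (c a : EuclideanSpace ℝ (Fin d) → ℝ)
    (B : EuclideanSpace ℝ (Fin d) → EuclideanSpace ℝ (Fin d))
    (h k : EuclideanSpace ℝ (Fin d) → ℝ → ℝ) (x : EuclideanSpace ℝ (Fin d)) (t : ℝ)
    (z : ℝ) (q : EuclideanSpace ℝ (Fin d)) (r : ℝ) : ℝ :=
  let gradProd : EuclideanSpace ℝ (Fin d) := k x t • q + z • gradient (fun y => k y t) x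
  let timeProd : ℝ := k x t * r + deriv (k x) t * z
  (a x * k x t * z + inner ℝ (B x) gradProd) / k x t
    + c x * (iteratedDeriv 2 (fun s => 1 / k x s) t * k x t + iteratedDeriv 2 (h x) t / k x t) * z
    + 2 * c x * deriv (fun s => 1 / k x s) t * timeProd
    - Laplacian.laplacian (fun y => 1 / k y t) x * k x t * z
    - 2 * inner ℝ (gradient (fun y => 1 / k y t) x) gradProd

/-- The operator `𝓛 w = c w_tt - Δw - L(w, ∇w, w_t) + (c h_tt / h̃) ∫₀ᵗ w_t(x, τ) dτ`. -/
def volterraOp (Ω : Set (EuclideanSpace ℝ (Fin d))) (T : ℝ)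
    (c a : EuclideanSpace ℝ (Fin d) → ℝ)
    (B : EuclideanSpace ℝ (Fin d) → EuclideanSpace ℝ (Fin d))
    (h k : EuclideanSpace ℝ (Fin d) → ℝ → ℝ)
    (w : EuclideanSpace ℝ (Fin d) × ℝ → ℝ) (p : EuclideanSpace ℝ (Fin d) × ℝ) : ℝ :=
  c p.1 * timeDeriv2 Ω T w p - spaceLaplacian Ω T w p
    - lowerOrder c a B h k p.1 p.2 (w p) (spaceGrad Ω T w p) (timeDeriv Ω T w p)
    + c p.1 * iteratedDeriv 2 (h p.1) p.2 / k p.1 p.2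
        * ∫ τ in (0 : ℝ)..p.2, timeDeriv Ω T w (p.1, τ)

/-- The right-hand side
`𝓕(x, t) = - h_tt(x, t) (Δf + a f + B · ∇f)(x) / (h(x, 0) h̃(x, t))`,
with the weak derivatives of `f` on `ℝ^d`. -/
def volterraRhs (a : EuclideanSpace ℝ (Fin d) → ℝ)
    (B : EuclideanSpace ℝ (Fin d) → EuclideanSpace ℝ (Fin d))
    (h k : EuclideanSpace ℝ (Fin d) → ℝ → ℝ) (f : EuclideanSpace ℝ (Fin d) → ℝ)
    (p : EuclideanSpace ℝ (Fin d) × ℝ) : ℝ :=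
  -(iteratedDeriv 2 (h p.1) p.2 *
      ((∑ i : Fin d, weakDeriv (spaceFrame d) (Pi.single i 2) univ f p.1)
        + a p.1 * f p.1
        + ∑ i : Fin d, B p.1 i * weakDeriv (spaceFrame d) (Pi.single i 1) univ f p.1))
    / (h p.1 0 * k p.1 p.2)

/-- The functional `J_α(w) = ‖𝓛 w - 𝓕‖²_{L²(Ω × (0, T))} + α ‖w‖²_{H³(Ω × (0, T))}`,
with values in `[0, ∞]`. -/
def quasiReversibility (Ω : Set (EuclideanSpace ℝ (Fin d))) (T : ℝ)
    (c a : EuclideanSpace ℝ (Fin d) → ℝ)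
    (B : EuclideanSpace ℝ (Fin d) → EuclideanSpace ℝ (Fin d))
    (h k : EuclideanSpace ℝ (Fin d) → ℝ → ℝ) (f : EuclideanSpace ℝ (Fin d) → ℝ)
    (α : ℝ) (w : SpaceTimeL2 Ω T) : ℝ≥0∞ :=
  eLpNorm (fun p => volterraOp Ω T c a B h k w p - volterraRhs a B h k f p) 2
      (volume.restrict (cylinder Ω T)) ^ 2
    + ENNReal.ofReal α * hkNormSq (spaceTimeFrame d) 3 (cylinder Ω T) w

end Domain

end

/-! Sending `w` to its jet, the family of weak derivatives of order at most 3, embeds `H³(Q)`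
isometrically in a finite product of copies of `L²(Q)`. On jets the functional becomes `‖A y - F‖² +
α ‖y‖²`, so the claim is the Hilbert space fact that a Tikhonov functional with `α > 0` has exactly
one minimizer on a nonempty closed convex set (`exists_unique_tikhonov_minimizer`). The term `α
‖y‖²` supplies all the coercivity; no estimate for `𝓛` from below is needed.

Three facts make the reduction work.

The operator `𝓛` is bounded on jets (`isJetOperator_volterraOp`). Its coefficients are bounded on
`Q`: `h̃` is `C²` up to the boundary of a compact set and has no zero there, and `h_tt` is bounded
by hypothesis. The memory term is bounded on `L²(Q)` by Cauchy-Schwarz in time.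

The right-hand side `𝓕` is in `L²(Q)` (`memLp_volterraRhs`): it is a bounded factor times `L²`
derivatives of `f`, and `h(x, 0) = h̃(x, 0)` stays away from zero.

The jets of `K` form a closed convex set (`isClosed_jetSet`, `convex_jetSet`). Weak differentiation
is linear and closed in `L²`. A trace is defined by smooth approximation, so prescribed boundary
values survive convex combinations by linearity and `H³` limits by a diagonal argument
(`HasTrace.of_tendsto`); no trace inequality enters. -/

/-! ### Linear combinations and limits in `L²`. -/

lemma integral_linear_comb_mul {X : Type*} [MeasurableSpace X] {μ : Measure X}
    {u v φ : X → ℝ} (hu : MemLp u 2 μ)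
    (hv : MemLp v 2 μ) (hφ : MemLp φ 2 μ) (s t : ℝ) :
    ∫ x, (s * u x + t * v x) * φ x ∂μ = s * ∫ x, u x * φ x ∂μ + t * ∫ x, v x * φ x ∂μ := by
  have h₁ : Integrable (fun x => u x * φ x) μ := hu.integrable_mul hφ
  have h₂ : Integrable (fun x => v x * φ x) μ := hv.integrable_mul hφ
  rw [← integral_const_mul, ← integral_const_mul, ← integral_add (h₁.const_mul s) (h₂.const_mul t)]
  congr 1; ext x; ring

/-- Pairing with an `L²` function is an inner product, hence continuous. This lets the identities
that define weak derivatives pass to `L²` limits. -/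
lemma tendsto_integral_mul_of_tendsto_Lp {ι X : Type*} [MeasurableSpace X] {l : Filter ι}
    {μ : Measure X}
    {y : ι → Lp ℝ 2 μ} {z : Lp ℝ 2 μ} (h : Tendsto y l (𝓝 z)) {φ : X → ℝ} (hφ : MemLp φ 2 μ) :
    Tendsto (fun j => ∫ x, y j x * φ x ∂μ) l (𝓝 (∫ x, z x * φ x ∂μ)) := by
  have e : ∀ w : Lp ℝ 2 μ, ∫ x, w x * φ x ∂μ = inner ℝ (hφ.toLp φ) w := by
    intro w
    rw [L2.inner_def]
    refine integral_congr_ae ?_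
    filter_upwards [hφ.coeFn_toLp] with x hx
    simp [hx]
  simp only [e]
  exact tendsto_const_nhds.inner h

lemma tendsto_eLpNorm_linear_comb {X : Type*} [MeasurableSpace X] {μ : Measure X}
    {F G : ℕ → X → ℝ} {f g r : X → ℝ} (s t : ℝ)
    (hF : ∀ j, AEStronglyMeasurable (F j) μ) (hG : ∀ j, AEStronglyMeasurable (G j) μ)
    (hf : AEStronglyMeasurable f μ) (hg : AEStronglyMeasurable g μ)
    (hF' : Tendsto (fun j => eLpNorm (fun x => F j x - f x) 2 μ) atTop (𝓝 0))
    (hG' : Tendsto (fun j => eLpNorm (fun x => G j x - g x) 2 μ) atTop (𝓝 0))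
    (hr : r =ᵐ[μ] fun x => s * f x + t * g x) :
    Tendsto (fun j => eLpNorm (fun x => (s * F j x + t * G j x) - r x) 2 μ) atTop (𝓝 0) := by
  have lim : Tendsto (fun j => ‖s‖ₑ * eLpNorm (fun x => F j x - f x) 2 μ
      + ‖t‖ₑ * eLpNorm (fun x => G j x - g x) 2 μ) atTop (𝓝 0) := by
    simpa using (ENNReal.Tendsto.const_mul hF' (Or.inr enorm_ne_top)).add
      (ENNReal.Tendsto.const_mul hG' (Or.inr enorm_ne_top))
  refine tendsto_of_tendsto_of_tendsto_of_le_of_le tendsto_const_nhds lim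
    (fun _ => zero_le) fun j => ?_
  have e : eLpNorm (fun x => (s * F j x + t * G j x) - r x) 2 μ
      = eLpNorm (s • (fun x => F j x - f x) + t • (fun x => G j x - g x)) 2 μ := by
    refine eLpNorm_congr_ae ?_
    filter_upwards [hr] with x hx
    simp only [hx, Pi.add_apply, Pi.smul_apply, smul_eq_mul]
    ring
  rw [e]
  refine (eLpNorm_add_le (((hF j).sub hf).const_smul s) (((hG j).sub hg).const_smul t)
    (by norm_num)).trans ?_
  rw [eLpNorm_const_smul, eLpNorm_const_smul]
  exact le_rfl

/-! ### Weak derivatives and traces: linearity, uniqueness, limits. -/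

section SobolevLemmas

variable {V : Type*} [NormedAddCommGroup V] [NormedSpace ℝ V] {n : ℕ}

lemma contDiff_fderiv_apply {u : V → ℝ} (hu : ContDiff ℝ ∞ u) (v : V) :
    ContDiff ℝ ∞ fun x => fderiv ℝ u x v :=
  (hu.fderiv_right (m := ∞) (by simp)).clm_apply contDiff_const

lemma hasCompactSupport_fderiv_apply {u : V → ℝ} (hu : HasCompactSupport u) (v : V) :
    HasCompactSupport fun x => fderiv ℝ u x v :=
  (hu.fderiv ℝ).comp_left (g := fun L : V →L[ℝ] ℝ => L v) (by simp)

lemma fderiv_apply_linear_comb {u v : V → ℝ} (hu : ContDiff ℝ ∞ u) (hv : ContDiff ℝ ∞ v)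
    (s t : ℝ) (x w : V) :
    fderiv ℝ (fun y => s * u y + t * v y) x w = s * fderiv ℝ u x w + t * fderiv ℝ v x w := by
  have hu' : DifferentiableAt ℝ u x := (hu.differentiable (by simp)) x
  have hv' : DifferentiableAt ℝ v x := (hv.differentiable (by simp)) x
  rw [fderiv_fun_add (hu'.const_mul s) (hv'.const_mul t), fderiv_const_mul hu',
    fderiv_const_mul hv']
  simp

lemma contDiff_partialDeriv (b : Fin n → V) (α : Fin n → ℕ) {φ : V → ℝ} (hφ : ContDiff ℝ ∞ φ) :
    ContDiff ℝ ∞ (partialDeriv b α φ) := by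
  unfold partialDeriv
  induction List.finRange n with
  | nil => exact hφ
  | cons i l ih =>
    rw [List.foldr_cons]
    induction α i with
    | zero => exact ih
    | succ m hm =>
      rw [Function.iterate_succ_apply']
      exact contDiff_fderiv_apply hm _

lemma hasCompactSupport_partialDeriv (b : Fin n → V) (α : Fin n → ℕ) {φ : V → ℝ}
    (hφ : HasCompactSupport φ) : HasCompactSupport (partialDeriv b α φ) := by
  unfold partialDeriv
  induction List.finRange n with
  | nil => exact hφ
  | cons i l ih =>
    rw [List.foldr_cons]
    induction α i with
    | zero => exact ih
    | succ m hm =>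
      rw [Function.iterate_succ_apply']
      exact hasCompactSupport_fderiv_apply hm _

lemma partialDeriv_linear_comb (b : Fin n → V) (α : Fin n → ℕ) {φ ψ : V → ℝ}
    (hφ : ContDiff ℝ ∞ φ) (hψ : ContDiff ℝ ∞ ψ) (s t : ℝ) :
    partialDeriv b α (fun x => s * φ x + t * ψ x) =
      fun x => s * partialDeriv b α φ x + t * partialDeriv b α ψ x := by
  -- The induction carries the smoothness of the functions reached so far, because linearity of the
  -- next `fderiv` requires it.
  have key : ∀ l : List (Fin n), ∃ φ' ψ' : V → ℝ, ContDiff ℝ ∞ φ' ∧ ContDiff ℝ ∞ ψ' ∧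
      l.foldr (fun i g => (fun (u : V → ℝ) (x : V) => fderiv ℝ u x (b i))^[α i] g) φ = φ' ∧
      l.foldr (fun i g => (fun (u : V → ℝ) (x : V) => fderiv ℝ u x (b i))^[α i] g) ψ = ψ' ∧
      l.foldr (fun i g => (fun (u : V → ℝ) (x : V) => fderiv ℝ u x (b i))^[α i] g)
        (fun x => s * φ x + t * ψ x) = fun x => s * φ' x + t * ψ' x := by
    intro l
    induction l with
    | nil => exact ⟨φ, ψ, hφ, hψ, rfl, rfl, rfl⟩
    | cons i l ih =>
      obtain ⟨φ₁, ψ₁, hφ₁, hψ₁, e₁, e₂, e₃⟩ := ih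
      simp only [List.foldr_cons, e₁, e₂, e₃]
      generalize α i = m
      induction m with
      | zero => exact ⟨φ₁, ψ₁, hφ₁, hψ₁, rfl, rfl, rfl⟩
      | succ m hm =>
        obtain ⟨φ₂, ψ₂, hφ₂, hψ₂, f₁, f₂, f₃⟩ := hm
        simp only [Function.iterate_succ_apply', f₁, f₂, f₃]
        exact ⟨_, _, contDiff_fderiv_apply hφ₂ (b i), contDiff_fderiv_apply hψ₂ (b i), rfl, rfl,
          funext fun x => fderiv_apply_linear_comb hφ₂ hψ₂ s t x (b i)⟩
  obtain ⟨φ', ψ', -, -, e₁, e₂, e₃⟩ := key (List.finRange n)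
  unfold partialDeriv
  rw [e₁, e₂, e₃]

lemma mem_multiIndices {k : ℕ} {α : Fin n → ℕ} : α ∈ multiIndices n k ↔ ∑ i, α i ≤ k := by
  simp only [multiIndices, Finset.mem_filter, Fintype.mem_piFinset, Finset.mem_range,
    and_iff_right_iff_imp]
  intro h i
  have := Finset.single_le_sum (f := α) (fun j _ => Nat.zero_le _) (Finset.mem_univ i)
  omega

/-- A boundary operator which is linear on smooth functions. -/
def IsLinearOnSmooth (𝓑 : (V → ℝ) → V → ℝ) : Prop :=
  ∀ φ ψ : V → ℝ, ContDiff ℝ ∞ φ → ContDiff ℝ ∞ ψ → ∀ s t : ℝ,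
    𝓑 (fun x => s * φ x + t * ψ x) = fun x => s * 𝓑 φ x + t * 𝓑 ψ x

lemma isLinearOnSmooth_id : IsLinearOnSmooth (fun φ : V → ℝ => φ) :=
  fun _ _ _ _ _ _ => rfl

lemma isLinearOnSmooth_fderiv (v : V → V) :
    IsLinearOnSmooth (fun (φ : V → ℝ) x => fderiv ℝ φ x (v x)) :=
  fun _ _ hφ hψ s t => funext fun x => fderiv_apply_linear_comb hφ hψ s t x (v x)

section Measure

variable [MeasureSpace V]

lemma IsWeakDeriv.congr {b : Fin n → V} {α : Fin n → ℕ} {U : Set V} {u u' v v' : V → ℝ}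
    (h : IsWeakDeriv b α U u v) (hu : u =ᵐ[volume.restrict U] u')
    (hv : v =ᵐ[volume.restrict U] v') : IsWeakDeriv b α U u' v' := by
  intro φ h₁ h₂ h₃
  have := h φ h₁ h₂ h₃
  rw [integral_congr_ae (g := fun x => u' x * partialDeriv b α φ x)
    (by filter_upwards [hu] with x hx; rw [hx]),
    integral_congr_ae (g := fun x => v' x * φ x) (f := fun x => v x * φ x)
    (by filter_upwards [hv] with x hx; rw [hx])] at this
  exact this

lemma weakDeriv_spec {b : Fin n → V} {α : Fin n → ℕ} {U : Set V} {u : V → ℝ}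
    (h : ∃ v : V → ℝ, MemLp v 2 (volume.restrict U) ∧ IsWeakDeriv b α U u v) :
    MemLp (weakDeriv b α U u) 2 (volume.restrict U) ∧
      IsWeakDeriv b α U u (weakDeriv b α U u) := by
  unfold weakDeriv
  rw [dif_pos h]
  exact Classical.choose_spec h

lemma MemHk.weakDeriv_spec {b : Fin n → V} {α : Fin n → ℕ} {U : Set V} {u : V → ℝ} {k : ℕ}
    (h : MemHk b k U u) (hα : ∑ i, α i ≤ k) :
    MemLp (weakDeriv b α U u) 2 (volume.restrict U) ∧
      IsWeakDeriv b α U u (weakDeriv b α U u) :=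
  _root_.weakDeriv_spec (h.2 α hα)

lemma MemHk.congr {b : Fin n → V} {U : Set V} {k : ℕ} {u v : V → ℝ} (hu : MemHk b k U u)
    (h : u =ᵐ[volume.restrict U] v) : MemHk b k U v :=
  ⟨hu.1.ae_eq h, fun α hα => (hu.2 α hα).imp fun _ hw => ⟨hw.1, hw.2.congr h .rfl⟩⟩

lemma MemHk.mono {b : Fin n → V} {U : Set V} {k k' : ℕ} {u : V → ℝ} (hu : MemHk b k U u)
    (h : k' ≤ k) : MemHk b k' U u :=
  ⟨hu.1, fun α hα => hu.2 α (hα.trans h)⟩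

variable [BorelSpace V]

/-- For a fixed boundary value, having that trace is a closed condition in `H^k`. -/
lemma HasTrace.of_tendsto {b : Fin n → V} {U : Set V} {k m : ℕ} {σ : Measure V}
    {𝓑 : (V → ℝ) → V → ℝ} {u : ℕ → V → ℝ} {v z : V → ℝ} (hu : ∀ j, MemHk b m U (u j))
    (hv : MemHk b m U v) (hkm : k ≤ m) (h : ∀ j, HasTrace b k U σ 𝓑 (u j) z)
    (hlim : ∀ α : Fin n → ℕ, ∑ i, α i ≤ k → Tendsto (fun j =>
      eLpNorm (fun x => weakDeriv b α U (u j) x - weakDeriv b α U v x) 2 (volume.restrict U))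
      atTop (𝓝 0)) : HasTrace b k U σ 𝓑 v z := by
  choose hz φ φ₁ φ₂ φ₃ φ₄ using h
  -- Diagonal choice: one approximant of `u j` is within `1/(j+1)` in every derivative and in the
  -- boundary value at once, since there are only finitely many multi-indices.
  have hex : ∀ j : ℕ, ∃ i : ℕ, (∀ α ∈ multiIndices n k,
      eLpNorm (fun x => partialDeriv b α (φ j i) x - weakDeriv b α U (u j) x) 2
        (volume.restrict U) ≤ ((j : ℝ≥0∞) + 1)⁻¹) ∧
      eLpNorm (fun x => 𝓑 (φ j i) x - z x) 2 σ ≤ ((j : ℝ≥0∞) + 1)⁻¹ := by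
    intro j
    have hpos : (0 : ℝ≥0∞) < ((j : ℝ≥0∞) + 1)⁻¹ := by
      rw [ENNReal.inv_pos]; finiteness
    refine Eventually.exists (f := atTop) (Eventually.and ?_ ?_)
    · rw [Filter.eventually_all_finset]
      intro α hα
      exact (φ₃ j α (mem_multiIndices.1 hα)).eventually_le_const hpos
    · exact (φ₄ j).eventually_le_const hpos
  choose i hi hi' using hex
  have hinv : Tendsto (fun j : ℕ => ((j : ℝ≥0∞) + 1)⁻¹) atTop (𝓝 0) := by
    have := ENNReal.tendsto_inv_nat_nhds_zero.comp (tendsto_add_atTop_nat 1)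
    refine this.congr fun j => ?_
    simp
  refine ⟨hz 0, fun j => φ j (i j), fun j => φ₁ _ _, fun j => φ₂ _ _, fun α hα => ?_, ?_⟩
  · have lim := hinv.add (hlim α hα)
    rw [add_zero] at lim
    refine tendsto_of_tendsto_of_tendsto_of_le_of_le tendsto_const_nhds lim
      (fun _ => zero_le) fun j => ?_
    have mj := ((hu j).weakDeriv_spec (hα.trans hkm)).1.1
    have mv := (hv.weakDeriv_spec (hα.trans hkm)).1.1
    have mφ : AEStronglyMeasurable (partialDeriv b α (φ j (i j))) (volume.restrict U) :=
      (contDiff_partialDeriv b α (φ₁ j (i j))).continuous.aestronglyMeasurable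
    refine le_trans ?_ (add_le_add (hi j α (mem_multiIndices.2 hα)) le_rfl)
    refine le_trans (le_of_eq ?_) (eLpNorm_add_le (mφ.sub mj) (mj.sub mv) (by norm_num))
    congr 1
    ext x
    simp
  · exact tendsto_of_tendsto_of_tendsto_of_le_of_le tendsto_const_nhds hinv
      (fun _ => zero_le) hi'

variable [IsFiniteMeasureOnCompacts (volume : Measure V)]

lemma memLp_of_testFunction (U : Set V) {φ : V → ℝ} (h : ContDiff ℝ ∞ φ)
    (h' : HasCompactSupport φ) : MemLp φ 2 (volume.restrict U) :=
  (h.continuous.memLp_of_hasCompactSupport h').restrict U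

lemma memLp_partialDeriv_of_testFunction (b : Fin n → V) (α : Fin n → ℕ) (U : Set V) {φ : V → ℝ}
    (h : ContDiff ℝ ∞ φ) (h' : HasCompactSupport φ) :
    MemLp (partialDeriv b α φ) 2 (volume.restrict U) :=
  memLp_of_testFunction U (contDiff_partialDeriv b α h) (hasCompactSupport_partialDeriv b α h')

lemma IsWeakDeriv.linear_comb {b : Fin n → V} {α : Fin n → ℕ} {U : Set V} {u u' v v' : V → ℝ}
    (hu : MemLp u 2 (volume.restrict U)) (hu' : MemLp u' 2 (volume.restrict U))
    (hv : MemLp v 2 (volume.restrict U)) (hv' : MemLp v' 2 (volume.restrict U))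
    (h : IsWeakDeriv b α U u v) (h' : IsWeakDeriv b α U u' v') (s t : ℝ) :
    IsWeakDeriv b α U (fun x => s * u x + t * u' x) (fun x => s * v x + t * v' x) := by
  intro φ h₁ h₂ h₃
  rw [integral_linear_comb_mul hu hu' (memLp_partialDeriv_of_testFunction b α U h₁ h₂),
    integral_linear_comb_mul hv hv' (memLp_of_testFunction U h₁ h₂), h φ h₁ h₂ h₃, h' φ h₁ h₂ h₃]
  ring

lemma IsWeakDeriv.of_tendsto {b : Fin n → V} {α : Fin n → ℕ} {U : Set V} {ι : Type*}
    {l : Filter ι} [l.NeBot] {y y' : ι → Lp ℝ 2 (volume.restrict U)}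
    {z z' : Lp ℝ 2 (volume.restrict U)} (h : Tendsto y l (𝓝 z)) (h' : Tendsto y' l (𝓝 z'))
    (hy : ∀ j, IsWeakDeriv b α U (y j) (y' j)) : IsWeakDeriv b α U z z' := by
  intro φ h₁ h₂ h₃
  refine tendsto_nhds_unique
    (tendsto_integral_mul_of_tendsto_Lp h (memLp_partialDeriv_of_testFunction b α U h₁ h₂)) ?_
  simp only [hy _ φ h₁ h₂ h₃]
  exact (tendsto_integral_mul_of_tendsto_Lp h' (memLp_of_testFunction U h₁ h₂)).const_mul _

lemma MemHk.linear_comb {b : Fin n → V} {U : Set V} {k : ℕ} {u v : V → ℝ} (hu : MemHk b k U u)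
    (hv : MemHk b k U v) (s t : ℝ) : MemHk b k U (fun x => s * u x + t * v x) :=
  ⟨(hu.1.const_mul s).add (hv.1.const_mul t), fun _ hα =>
    ⟨_, ((hu.weakDeriv_spec hα).1.const_mul s).add ((hv.weakDeriv_spec hα).1.const_mul t),
      (hu.weakDeriv_spec hα).2.linear_comb hu.1 hv.1 (hu.weakDeriv_spec hα).1
        (hv.weakDeriv_spec hα).1 (hv.weakDeriv_spec hα).2 s t⟩⟩

variable [FiniteDimensional ℝ V]

/-- The fundamental lemma of the calculus of variations: `v - v'` is locally integrable, being `L²`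
on compact sets of finite measure, and is annihilated by every test function. -/
lemma IsWeakDeriv.unique {b : Fin n → V} {α : Fin n → ℕ} {U : Set V} (hU : IsOpen U)
    {u v v' : V → ℝ} (hv : MemLp v 2 (volume.restrict U)) (hv' : MemLp v' 2 (volume.restrict U))
    (h : IsWeakDeriv b α U u v) (h' : IsWeakDeriv b α U u v') : v =ᵐ[volume.restrict U] v' := by
  have hloc : LocallyIntegrableOn (v - v') U := by
    refine (locallyIntegrableOn_iff hU.isLocallyClosed).2 fun K hK hKc => ?_
    have hm : MemLp (v - v') 2 (volume.restrict K) :=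
      (hv.sub hv').mono_measure (Measure.restrict_mono hK le_rfl)
    have : IsFiniteMeasure ((volume : Measure V).restrict K) :=
      ⟨by simpa using hKc.measure_lt_top⟩
    exact hm.integrable (by norm_num)
  have key := hU.ae_eq_zero_of_integral_contDiff_smul_eq_zero hloc (by
    intro φ h₁ h₂ h₃
    have e := (h φ h₁ h₂ h₃).symm.trans (h' φ h₁ h₂ h₃)
    have e' : ∫ x in U, v x * φ x = ∫ x in U, v' x * φ x :=
      mul_left_cancel₀ (pow_ne_zero _ (by norm_num)) e
    have hφ := memLp_of_testFunction U h₁ h₂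
    have hs : ∫ x in U, φ x • (v - v') x = 0 := by
      have := integral_linear_comb_mul hv hv' hφ 1 (-1)
      rw [e'] at this
      rw [← integral_congr_ae (f := fun x => (1 * v x + -1 * v' x) * φ x), this]
      · ring
      · refine ae_of_all _ fun x => ?_
        simp; ring
    rw [← hs, setIntegral_eq_integral_of_forall_compl_eq_zero]
    intro x hx
    rw [image_eq_zero_of_notMem_tsupport fun hx' => hx (h₃ hx'), zero_smul])
  filter_upwards [(ae_restrict_iff' hU.measurableSet).2 key] with x hx
  exact sub_eq_zero.1 hx

/-- Makes the arbitrary choice in `weakDeriv` harmless: to identify it, it suffices to exhibit any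
`L²` weak derivative. -/
lemma weakDeriv_ae_eq {b : Fin n → V} {α : Fin n → ℕ} {U : Set V} (hU : IsOpen U)
    {u v : V → ℝ} (hv : MemLp v 2 (volume.restrict U)) (h : IsWeakDeriv b α U u v) :
    weakDeriv b α U u =ᵐ[volume.restrict U] v := by
  obtain ⟨h₁, h₂⟩ := weakDeriv_spec ⟨v, hv, h⟩
  exact h₂.unique hU h₁ hv h

lemma weakDeriv_zero_ae_eq {b : Fin n → V} {U : Set V} (hU : IsOpen U)
    {u : V → ℝ} (hu : MemLp u 2 (volume.restrict U)) :
    weakDeriv b 0 U u =ᵐ[volume.restrict U] u := by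
  refine weakDeriv_ae_eq hU hu fun φ _ _ _ => ?_
  have : partialDeriv b 0 φ = φ := by
    unfold partialDeriv
    induction List.finRange n with
    | nil => rfl
    | cons i l ih => simp
  simp [this]

lemma MemHk.weakDeriv_linear_comb {b : Fin n → V} {U : Set V} (hU : IsOpen U) {k : ℕ}
    {u v : V → ℝ} (hu : MemHk b k U u) (hv : MemHk b k U v) (s t : ℝ) {α : Fin n → ℕ}
    (hα : ∑ i, α i ≤ k) : weakDeriv b α U (fun x => s * u x + t * v x) =ᵐ[volume.restrict U]
      fun x => s * weakDeriv b α U u x + t * weakDeriv b α U v x :=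
  weakDeriv_ae_eq hU
    (((hu.weakDeriv_spec hα).1.const_mul s).add ((hv.weakDeriv_spec hα).1.const_mul t))
    ((hu.weakDeriv_spec hα).2.linear_comb hu.1 hv.1 (hu.weakDeriv_spec hα).1
        (hv.weakDeriv_spec hα).1 (hv.weakDeriv_spec hα).2 s t)

lemma MemHk.weakDeriv_congr {b : Fin n → V} {U : Set V} (hU : IsOpen U) {k : ℕ} {u v : V → ℝ}
    (hu : MemHk b k U u) (h : u =ᵐ[volume.restrict U] v) {α : Fin n → ℕ} (hα : ∑ i, α i ≤ k) :
    weakDeriv b α U v =ᵐ[volume.restrict U] weakDeriv b α U u :=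
  weakDeriv_ae_eq hU (hu.weakDeriv_spec hα).1 ((hu.weakDeriv_spec hα).2.congr h .rfl)

/-! ### Traces -/


/-- The same combination of the two approximating sequences works, because `𝓑` is linear on smooth
functions. -/
lemma HasTrace.linear_comb {b : Fin n → V} {U : Set V} (hU : IsOpen U) {k m : ℕ}
    {σ : Measure V} {𝓑 : (V → ℝ) → V → ℝ} (h𝓑 : IsLinearOnSmooth 𝓑) {u u' z z' : V → ℝ}
    (hu : MemHk b m U u) (hu' : MemHk b m U u') (hkm : k ≤ m) (h : HasTrace b k U σ 𝓑 u z)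
    (h' : HasTrace b k U σ 𝓑 u' z') (s t : ℝ) :
    HasTrace b k U σ 𝓑 (fun x => s * u x + t * u' x) (fun x => s * z x + t * z' x) := by
  obtain ⟨hz, φ, φ₁, φ₂, φ₃, φ₄⟩ := h
  obtain ⟨hz', ψ, ψ₁, ψ₂, ψ₃, ψ₄⟩ := h'
  refine ⟨(hz.const_mul s).add (hz'.const_mul t), fun j x => s * φ j x + t * ψ j x,
    fun j => (contDiff_const.mul (φ₁ j)).add (contDiff_const.mul (ψ₁ j)), fun j => ?_,
    fun α hα => ?_, ?_⟩
  · rw [h𝓑 _ _ (φ₁ j) (ψ₁ j)]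
    exact ((φ₂ j).const_mul s).add ((ψ₂ j).const_mul t)
  · simp only [partialDeriv_linear_comb b α (φ₁ _) (ψ₁ _)]
    exact tendsto_eLpNorm_linear_comb s t
      (fun j => (contDiff_partialDeriv b α (φ₁ j)).continuous.aestronglyMeasurable)
      (fun j => (contDiff_partialDeriv b α (ψ₁ j)).continuous.aestronglyMeasurable)
      (hu.weakDeriv_spec (hα.trans hkm)).1.1 (hu'.weakDeriv_spec (hα.trans hkm)).1.1
      (φ₃ α hα) (ψ₃ α hα) (hu.weakDeriv_linear_comb hU hu' s t (hα.trans hkm))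
  · simp only [h𝓑 _ _ (φ₁ _) (ψ₁ _)]
    exact tendsto_eLpNorm_linear_comb s t (fun j => (φ₂ j).1) (fun j => (ψ₂ j).1) hz.1 hz'.1
      φ₄ ψ₄ .rfl

/-- The approximation sees `u` only through its weak derivatives, so the trace belongs to the class
of `u` in `L²(U)`, even though `σ` may live on a null set. -/
lemma HasTrace.congr {b : Fin n → V} {U : Set V} (hU : IsOpen U) {k m : ℕ} {σ : Measure V}
    {𝓑 : (V → ℝ) → V → ℝ} {u v z : V → ℝ} (hu : MemHk b m U u) (hkm : k ≤ m)
    (h : HasTrace b k U σ 𝓑 u z) (huv : u =ᵐ[volume.restrict U] v) : HasTrace b k U σ 𝓑 v z := by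
  obtain ⟨hz, φ, φ₁, φ₂, φ₃, φ₄⟩ := h
  refine ⟨hz, φ, φ₁, φ₂, fun α hα => (φ₃ α hα).congr fun j => eLpNorm_congr_ae ?_, φ₄⟩
  filter_upwards [hu.weakDeriv_congr hU huv (hα.trans hkm)] with x hx
  rw [hx]

end Measure
end SobolevLemmas

/-! ### Jets: `H^k` as a subset of a product of `L²` spaces. -/

section JetSet

variable {V : Type*} [NormedAddCommGroup V] [NormedSpace ℝ V] [MeasureSpace V] {n : ℕ}

/-- The Hilbert space of families `(y_α)_{|α| ≤ k}` in `L²(U)`. -/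
abbrev JetSpace (n k : ℕ) (U : Set V) : Type _ :=
  PiLp 2 fun _ : multiIndices n k => Lp ℝ 2 ((volume : Measure V).restrict U)

/-- The families of weak derivatives of the elements of `K`. -/
def jetSet (b : Fin n → V) (k : ℕ) (U : Set V) (K : Set (Lp ℝ 2 ((volume : Measure V).restrict U))) :
    Set (JetSpace n k U) :=
  {y | ∃ w ∈ K, ∀ β : multiIndices n k, y β =ᵐ[volume.restrict U] weakDeriv b β U w}

lemma exists_jet {b : Fin n → V} {k : ℕ} {U : Set V} {w : V → ℝ} (hw : MemHk b k U w) :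
    ∃ y : JetSpace n k U, ∀ β : multiIndices n k, y β =ᵐ[volume.restrict U] weakDeriv b β U w :=
  ⟨WithLp.toLp 2 fun β => (hw.weakDeriv_spec (mem_multiIndices.1 β.2)).1.toLp _,
    fun β => (hw.weakDeriv_spec (mem_multiIndices.1 β.2)).1.coeFn_toLp⟩

lemma hkNormSq_eq_norm_jet_sq {b : Fin n → V} {k : ℕ} {U : Set V} {w : V → ℝ} {y : JetSpace n k U}
    (hy : ∀ β : multiIndices n k, y β =ᵐ[volume.restrict U] weakDeriv b β U w) :
    hkNormSq b k U w = ENNReal.ofReal (‖y‖ ^ 2) := by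
  rw [PiLp.norm_sq_eq_of_L2, ENNReal.ofReal_sum_of_nonneg fun _ _ => by positivity,
    hkNormSq, ← Finset.sum_coe_sort]
  refine Finset.sum_congr rfl fun β _ => ?_
  rw [← eLpNorm_congr_ae (hy β), ENNReal.ofReal_pow (norm_nonneg _), ofReal_norm, Lp.enorm_def]

/-- The multi-index `0`. -/
def zeroIndex (n k : ℕ) : multiIndices n k := ⟨0, mem_multiIndices.2 (by simp)⟩

variable [BorelSpace V] [IsFiniteMeasureOnCompacts (volume : Measure V)] [FiniteDimensional ℝ V]

/-- A jet determines its function, so uniqueness of a minimizing jet gives uniqueness of the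
minimizer. -/
lemma jet_zeroIndex {b : Fin n → V} {k : ℕ} {U : Set V} (hU : IsOpen U)
    {w : Lp ℝ 2 ((volume : Measure V).restrict U)} {y : JetSpace n k U}
    (hy : ∀ β : multiIndices n k, y β =ᵐ[volume.restrict U] weakDeriv b β U w) :
    y (zeroIndex n k) = w :=
  Lp.ext ((hy (zeroIndex n k)).trans (weakDeriv_zero_ae_eq hU (Lp.memLp w)))

lemma Lp.coeFn_linear_comb {X : Type*} [MeasurableSpace X] {μ : Measure X} (s t : ℝ)
    (u v : Lp ℝ 2 μ) : (s • u + t • v : Lp ℝ 2 μ) =ᵐ[μ] fun x => s * u x + t * v x := by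
  filter_upwards [Lp.coeFn_add (s • u) (t • v), Lp.coeFn_smul s u, Lp.coeFn_smul t v]
    with x h₁ h₂ h₃
  rw [h₁, Pi.add_apply, h₂, h₃]
  rfl

lemma convex_jetSet {b : Fin n → V} {k : ℕ} {U : Set V} (hU : IsOpen U)
    {K : Set (Lp ℝ 2 ((volume : Measure V).restrict U))} (hK : ∀ w ∈ K, MemHk b k U w)
    (hK' : Convex ℝ K) : Convex ℝ (jetSet b k U K) := by
  rintro y ⟨w, hw, hy⟩ y' ⟨w', hw', hy'⟩ s t hs ht hst
  refine ⟨s • w + t • w', hK' hw hw' hs ht hst, fun β => ?_⟩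
  have hβ := mem_multiIndices.1 β.2
  have h₁ := ((hK w hw).linear_comb (hK w' hw') s t).weakDeriv_congr hU
    (Lp.coeFn_linear_comb s t w w').symm hβ
  filter_upwards [Lp.coeFn_linear_comb s t (y β) (y' β), h₁, hy β, hy' β,
    (hK w hw).weakDeriv_linear_comb hU (hK w' hw') s t hβ] with x e₁ e₂ e₃ e₄ e₅
  rw [e₂, e₅, ← e₃, ← e₄, ← e₁]
  rfl

/-- Weak differentiation is a closed operator: the components of a limit of jets are weak
derivatives of its zeroth component. Hence closedness in the product only asks that `K` be
sequentially closed for convergence in `H^k`. -/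
lemma isClosed_jetSet {b : Fin n → V} {k : ℕ} {U : Set V} (hU : IsOpen U)
    {K : Set (Lp ℝ 2 ((volume : Measure V).restrict U))} (hK : ∀ w ∈ K, MemHk b k U w)
    (hK' : ∀ (w : ℕ → Lp ℝ 2 ((volume : Measure V).restrict U))
      (v : Lp ℝ 2 ((volume : Measure V).restrict U)), (∀ j, w j ∈ K) → MemHk b k U v →
      (∀ α : Fin n → ℕ, ∑ i, α i ≤ k → Tendsto (fun j => eLpNorm
        (fun x => weakDeriv b α U (w j) x - weakDeriv b α U v x) 2 (volume.restrict U))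
        atTop (𝓝 0)) → v ∈ K) :
    IsClosed (jetSet b k U K) := by
  refine IsSeqClosed.isClosed fun y z hy hz => ?_
  choose w hw hyw using hy
  have hlim : ∀ β, Tendsto (fun j => y j β) atTop (𝓝 (z β)) := fun β =>
    ((PiLp.continuous_apply 2 _ β).tendsto z).comp hz
  have hwd : ∀ β : multiIndices n k, IsWeakDeriv b β U (z (zeroIndex n k)) (z β) := by
    intro β
    refine IsWeakDeriv.of_tendsto (hlim _) (hlim β) fun j => ?_
    rw [jet_zeroIndex hU (hyw j)]
    exact ((hK _ (hw j)).weakDeriv_spec (mem_multiIndices.1 β.2)).2.congr .rfl (hyw j β).symm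
  have hz' : ∀ β : multiIndices n k,
      z β =ᵐ[volume.restrict U] weakDeriv b β U (z (zeroIndex n k)) :=
    fun β => (weakDeriv_ae_eq hU (Lp.memLp _) (hwd β)).symm
  refine ⟨z (zeroIndex n k), hK' w _ hw ⟨Lp.memLp _, fun α hα =>
    ⟨z ⟨α, mem_multiIndices.2 hα⟩, Lp.memLp _, hwd ⟨α, mem_multiIndices.2 hα⟩⟩⟩ fun α hα => ?_, hz'⟩
  have h := tendsto_iff_edist_tendsto_0.1 (hlim ⟨α, mem_multiIndices.2 hα⟩)
  refine h.congr fun j => ?_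
  rw [Lp.edist_def]
  refine eLpNorm_congr_ae ?_
  filter_upwards [hyw j ⟨α, mem_multiIndices.2 hα⟩, hz' ⟨α, mem_multiIndices.2 hα⟩] with x h₁ h₂
  rw [Pi.sub_apply, h₁, h₂]

end JetSet

/-! ### Tikhonov functionals on closed convex sets. -/

section Minimization

variable {H L : Type*} [NormedAddCommGroup H] [InnerProductSpace ℝ H] [CompleteSpace H]
  [NormedAddCommGroup L] [InnerProductSpace ℝ L] [CompleteSpace L]

/-- The Tikhonov functional of a bounded operator has a unique minimizer on a nonempty closed
convex set. -/
lemma exists_unique_tikhonov_minimizer (A : H →L[ℝ] L) (F : L) {α : ℝ} (hα : 0 < α) {S : Set H}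
    (hne : S.Nonempty) (hcl : IsClosed S) (hconv : Convex ℝ S) :
    ∃! y, y ∈ S ∧ ∀ z ∈ S, ‖A y - F‖ ^ 2 + α * ‖y‖ ^ 2 ≤ ‖A z - F‖ ^ 2 + α * ‖z‖ ^ 2 := by
  have hα' : √α ≠ 0 := (Real.sqrt_pos.2 hα).ne'
  -- With `G y = (A y, √α y)` the functional is the squared distance from `(F, 0)` to `G y`, so
  -- existence is projection onto the convex set `G '' S`.
  let G : H →ₗ[ℝ] WithLp 2 (L × H) :=
    (WithLp.linearEquiv 2 ℝ (L × H)).symm.toLinearMap ∘ₗ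
      (A : H →ₗ[ℝ] L).prod (√α • LinearMap.id)
  have hG : ∀ y, G y = WithLp.toLp 2 (A y, √α • y) := fun _ => rfl
  have hnorm : ∀ y, ‖WithLp.toLp 2 (F, (0 : H)) - G y‖ ^ 2 = ‖A y - F‖ ^ 2 + α * ‖y‖ ^ 2 := by
    intro y
    rw [hG, ← WithLp.toLp_sub, WithLp.prod_norm_sq_eq_of_L2]
    simp [norm_smul, mul_pow, Real.sq_sqrt hα.le, norm_sub_rev]
  -- The second component controls `y` because `√α ≠ 0`: convergence of `G (y j)` forces convergence
  -- of `y j`. The range of `A` need not be closed.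
  have hGcl : IsClosed (G '' S) := by
    refine IsSeqClosed.isClosed fun v z hv hz => ?_
    choose y hy hyv using hv
    obtain rfl : (fun j => G (y j)) = v := funext hyv
    have h₁ : Tendsto (fun j => A (y j)) atTop (𝓝 z.fst) :=
      ((WithLp.prod_continuous_ofLp 2 L H).fst.tendsto z).comp hz
    have h₂ : Tendsto (fun j => √α • y j) atTop (𝓝 z.snd) :=
      ((WithLp.prod_continuous_ofLp 2 L H).snd.tendsto z).comp hz
    have h₃ : Tendsto y atTop (𝓝 ((√α)⁻¹ • z.snd)) := by
      simpa [smul_smul, hα'] using h₂.const_smul (√α)⁻¹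
    refine ⟨_, hcl.mem_of_tendsto h₃ (Eventually.of_forall hy), ?_⟩
    rw [hG, tendsto_nhds_unique ((A.continuous.tendsto _).comp h₃) h₁, smul_smul,
      mul_inv_cancel₀ hα', one_smul]
    rfl
  obtain ⟨_, ⟨y, hy, rfl⟩, hmin⟩ := exists_norm_eq_iInf_of_complete_convex (hne.image G)
    hGcl.isComplete (hconv.linear_image G) (WithLp.toLp 2 (F, (0 : H)))
  have hymin : ∀ z ∈ S, ‖A y - F‖ ^ 2 + α * ‖y‖ ^ 2 ≤ ‖A z - F‖ ^ 2 + α * ‖z‖ ^ 2 := by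
    intro z hz
    rw [← hnorm, ← hnorm, hmin]
    refine pow_le_pow_left₀ (Real.iInf_nonneg fun _ => norm_nonneg _) ?_ 2
    exact ciInf_le (f := fun w : G '' S => ‖WithLp.toLp 2 (F, (0 : H)) - w‖)
      ⟨0, by rintro _ ⟨w, rfl⟩; exact norm_nonneg _⟩ ⟨G z, z, hz, rfl⟩
  refine ⟨y, ⟨hy, hymin⟩, fun z ⟨hz, hzmin⟩ => ?_⟩
  -- Uniqueness: at the midpoint of two minimizers the parallelogram laws lower the functional by at
  -- least `α ‖y - z‖² / 4`, which minimality forces to vanish.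
  have hm := hymin _ (hconv hy hz (a := 1 / 2) (b := 1 / 2) (by norm_num) (by norm_num)
    (by norm_num))
  have hyz := hzmin y hy
  have e₁ := parallelogram_law_with_norm ℝ (A y - F) (A z - F)
  have e₂ := parallelogram_law_with_norm ℝ y z
  have e₃ : A ((1 / 2 : ℝ) • y + (1 / 2 : ℝ) • z) - F
      = (1 / 2 : ℝ) • ((A y - F) + (A z - F)) := by
    simp only [map_add, map_smul]; module
  rw [e₃, ← smul_add, norm_smul, norm_smul] at hm
  norm_num at hm
  have : α * ‖y - z‖ ^ 2 ≤ 0 := by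
    nlinarith [mul_self_nonneg ‖A y - F - (A z - F)‖]
  have h0 : ‖y - z‖ ^ 2 ≤ 0 := by
    by_contra hcon
    push Not at hcon
    nlinarith [mul_pos hα hcon]
  have h1 : ‖y - z‖ = 0 := pow_eq_zero_iff (two_ne_zero) |>.1 (le_antisymm h0 (by positivity))
  exact (sub_eq_zero.1 (norm_eq_zero.1 h1)).symm

end Minimization

/-! ### Bounded operators on `L²`: multiplication and the Volterra integral. -/

section Operators

variable {X : Type*} [MeasurableSpace X]

lemma exists_clm_mul {μ : Measure X} {m : X → ℝ} (hm : MemLp m ⊤ μ) :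
    ∃ M : Lp ℝ 2 μ →L[ℝ] Lp ℝ 2 μ, ∀ u : Lp ℝ 2 μ, M u =ᵐ[μ] fun x => m x * u x := by
  refine ⟨(ContinuousLinearMap.mul ℝ ℝ).holderL μ ⊤ 2 2 (hm.toLp m), fun u => ?_⟩
  filter_upwards [(ContinuousLinearMap.mul ℝ ℝ).coeFn_holder (r := 2) (hm.toLp m) u,
    hm.coeFn_toLp] with x h₁ h₂
  rw [ContinuousLinearMap.holderL_apply_apply, h₁, h₂]
  rfl

lemma lintegral_sq_le (ν : Measure X) {f : X → ℝ≥0∞} (hf : AEMeasurable f ν) :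
    (∫⁻ x, f x ∂ν) ^ 2 ≤ ν univ * ∫⁻ x, f x ^ 2 ∂ν := by
  have h := ENNReal.lintegral_mul_le_Lp_mul_Lq ν Real.HolderConjugate.two_two hf
    (aemeasurable_const (b := (1 : ℝ≥0∞)))
  simp only [Pi.mul_apply, mul_one, lintegral_const, ENNReal.rpow_ofNat] at h
  refine (pow_le_pow_left' h 2).trans ?_
  rw [mul_pow, ← ENNReal.rpow_natCast, ← ENNReal.rpow_mul, ← ENNReal.rpow_natCast,
    ← ENNReal.rpow_mul]
  norm_num [mul_comm]

lemma eLpNorm_two_sq (ν : Measure X) (f : X → ℝ) :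
    eLpNorm f 2 ν ^ 2 = ∫⁻ x, ‖f x‖ₑ ^ 2 ∂ν := by
  have := eLpNorm_nnreal_pow_eq_lintegral (μ := ν) (f := f) (p := 2) (by norm_num)
  simpa using this

variable {μ : Measure X} {T : ℝ}

lemma ae_prod_Ioo {P : X → Prop} (hP : ∀ᵐ x ∂μ, P x) :
    ∀ᵐ p ∂μ.prod (volume.restrict (Ioo 0 T)), P p.1 ∧ p.2 ∈ Ioo 0 T :=
  (Measure.quasiMeasurePreserving_fst.ae hP).and
    (Measure.quasiMeasurePreserving_snd.ae (ae_restrict_mem measurableSet_Ioo))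

lemma uIoc_subset_Ioo_of_mem {t : ℝ} (ht : t ∈ Ioo 0 T) : uIoc 0 t ⊆ Ioo 0 T := by
  rw [uIoc_of_le ht.1.le]
  exact fun τ hτ => ⟨hτ.1, hτ.2.trans_lt ht.2⟩

/-- By Fubini, functions that agree almost everywhere agree almost everywhere on almost every time
line, so the integral depends only on the class of `g`. -/
lemma volterra_congr_ae {g g' : X × ℝ → ℝ} (h : g =ᵐ[μ.prod (volume.restrict (Ioo 0 T))] g') :
    (fun p : X × ℝ => ∫ τ in (0 : ℝ)..p.2, g (p.1, τ)) =ᵐ[μ.prod (volume.restrict (Ioo 0 T))]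
      fun p => ∫ τ in (0 : ℝ)..p.2, g' (p.1, τ) := by
  filter_upwards [ae_prod_Ioo (Measure.ae_ae_of_ae_prod h)] with p hp
  refine intervalIntegral.integral_congr_ae_restrict ?_
  exact ae_restrict_of_ae_restrict_of_subset (uIoc_subset_Ioo_of_mem hp.2) hp.1

lemma aestronglyMeasurable_volterra {g : X × ℝ → ℝ} (hg : StronglyMeasurable g) :
    AEStronglyMeasurable (fun p : X × ℝ => ∫ τ in (0 : ℝ)..p.2, g (p.1, τ))
      (μ.prod (volume.restrict (Ioo 0 T))) := by
  -- The moving upper limit becomes the indicator of `0 < τ ≤ t`, which leaves a parameter integral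
  -- of a jointly measurable function.
  have hs : MeasurableSet {q : (X × ℝ) × ℝ | 0 < q.2 ∧ q.2 ≤ q.1.2} :=
    (measurableSet_lt measurable_const measurable_snd).inter
      (measurableSet_le measurable_snd measurable_fst.snd)
  have hm : StronglyMeasurable fun q : (X × ℝ) × ℝ =>
      {q : (X × ℝ) × ℝ | 0 < q.2 ∧ q.2 ≤ q.1.2}.indicator (fun q => g (q.1.1, q.2)) q :=
    (hg.comp_measurable (measurable_fst.fst.prodMk measurable_snd)).indicator hs
  refine ⟨_, StronglyMeasurable.integral_prod_right (ν := (volume : Measure ℝ))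
    (f := fun p τ => {q : (X × ℝ) × ℝ | 0 < q.2 ∧ q.2 ≤ q.1.2}.indicator
      (fun q => g (q.1.1, q.2)) (p, τ)) hm, ?_⟩
  filter_upwards [ae_prod_Ioo (P := fun _ : X => True) (ae_of_all _ fun _ => trivial)] with p hp
  rw [intervalIntegral.integral_of_le hp.2.1.le, ← integral_indicator measurableSet_Ioc]
  rfl

/-- Cauchy-Schwarz gives `|∫₀ᵗ g|² ≤ T ∫₀ᵀ |g|²` on each time line; integrating over `t` yields the
second factor `T`. -/
lemma eLpNorm_volterra_le {g : X × ℝ → ℝ} (hg : StronglyMeasurable g) :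
    eLpNorm (fun p : X × ℝ => ∫ τ in (0 : ℝ)..p.2, g (p.1, τ)) 2
      (μ.prod (volume.restrict (Ioo 0 T)))
      ≤ ENNReal.ofReal T * eLpNorm g 2 (μ.prod (volume.restrict (Ioo 0 T))) := by
  refine (ENNReal.pow_le_pow_left_iff (n := 2) two_ne_zero).1 ?_
  rw [mul_pow, eLpNorm_two_sq, eLpNorm_two_sq]
  have hm : Measurable fun p : X × ℝ => ‖g p‖ₑ ^ 2 := (hg.enorm).pow_const 2
  have hint : Measurable fun x : X => ∫⁻ τ in Ioo 0 T, ‖g (x, τ)‖ₑ ^ 2 :=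
    hm.lintegral_prod_right'
  calc _ ≤ ∫⁻ p : X × ℝ, ENNReal.ofReal T * (∫⁻ τ in Ioo 0 T, ‖g (p.1, τ)‖ₑ ^ 2)
        ∂μ.prod (volume.restrict (Ioo 0 T)) := by
        refine lintegral_mono_ae ?_
        filter_upwards [ae_prod_Ioo (P := fun _ : X => True) (ae_of_all _ fun _ => trivial)]
          with p hp
        have hsub := uIoc_subset_Ioo_of_mem hp.2
        rw [uIoc_of_le hp.2.1.le] at hsub
        rw [intervalIntegral.integral_of_le hp.2.1.le]
        refine (pow_le_pow_left' ((enorm_integral_le_lintegral_enorm _).trans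
          (lintegral_mono_set hsub)) 2).trans ?_
        refine (lintegral_sq_le _ ?_).trans (by simp)
        exact (hg.enorm.comp measurable_prodMk_left).aemeasurable
    _ = _ := by
        have hint' : Measurable fun p : X × ℝ => ∫⁻ τ in Ioo 0 T, ‖g (p.1, τ)‖ₑ ^ 2 :=
          hint.comp measurable_fst
        rw [lintegral_const_mul _ hint', lintegral_prod _ hint'.aemeasurable,
          lintegral_prod _ hm.aemeasurable]
        simp only [lintegral_const, Measure.restrict_apply_univ, Real.volume_Ioo, sub_zero]
        rw [lintegral_mul_const _ hint, sq]
        ring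

variable [IsFiniteMeasure μ]

lemma volterra_linear_comb_ae {g g' : X × ℝ → ℝ}
    (h : MemLp g 2 (μ.prod (volume.restrict (Ioo 0 T))))
    (h' : MemLp g' 2 (μ.prod (volume.restrict (Ioo 0 T)))) (r s : ℝ) :
    (fun p : X × ℝ => ∫ τ in (0 : ℝ)..p.2, (r * g (p.1, τ) + s * g' (p.1, τ)))
      =ᵐ[μ.prod (volume.restrict (Ioo 0 T))]
      fun p => r * (∫ τ in (0 : ℝ)..p.2, g (p.1, τ)) + s * ∫ τ in (0 : ℝ)..p.2, g' (p.1, τ) := by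
  -- Finiteness of `μ` puts `L²` inside `L¹`, and Fubini makes almost every slice integrable, as
  -- additivity of the inner integral requires.
  have i := (h.integrable (by norm_num)).prod_right_ae
  have i' := (h'.integrable (by norm_num)).prod_right_ae
  filter_upwards [ae_prod_Ioo (i.and i')] with p hp
  have j : IntervalIntegrable (fun τ => g (p.1, τ)) volume 0 p.2 := by
    rw [intervalIntegrable_iff]
    exact IntegrableOn.mono_set (t := Ioo 0 T) hp.1.1 (uIoc_subset_Ioo_of_mem hp.2)
  have j' : IntervalIntegrable (fun τ => g' (p.1, τ)) volume 0 p.2 := by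
    rw [intervalIntegrable_iff]
    exact IntegrableOn.mono_set (t := Ioo 0 T) hp.1.2 (uIoc_subset_Ioo_of_mem hp.2)
  rw [intervalIntegral.integral_add (j.const_mul r) (j'.const_mul s),
    intervalIntegral.integral_const_mul, intervalIntegral.integral_const_mul]

/-- All representatives `g` are allowed because the memory term integrates `timeDeriv`, a chosen
representative, and not the one that `Lp` provides. -/
lemma exists_clm_volterra :
    ∃ W : Lp ℝ 2 (μ.prod (volume.restrict (Ioo 0 T))) →L[ℝ]
        Lp ℝ 2 (μ.prod (volume.restrict (Ioo 0 T))),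
      ∀ (u : Lp ℝ 2 (μ.prod (volume.restrict (Ioo 0 T)))) (g : X × ℝ → ℝ),
        u =ᵐ[μ.prod (volume.restrict (Ioo 0 T))] g →
          W u =ᵐ[μ.prod (volume.restrict (Ioo 0 T))]
            fun p => ∫ τ in (0 : ℝ)..p.2, g (p.1, τ) := by
  have hsm := fun u : Lp ℝ 2 (μ.prod (volume.restrict (Ioo 0 T))) => Lp.stronglyMeasurable u
  have hmem : ∀ u : Lp ℝ 2 (μ.prod (volume.restrict (Ioo 0 T))),
      MemLp (fun p : X × ℝ => ∫ τ in (0 : ℝ)..p.2, u (p.1, τ)) 2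
        (μ.prod (volume.restrict (Ioo 0 T))) := fun u =>
    ⟨aestronglyMeasurable_volterra (hsm u), (eLpNorm_volterra_le (hsm u)).trans_lt
      (ENNReal.mul_lt_top ENNReal.ofReal_lt_top (Lp.memLp u).2)⟩
  have key : ∀ (r s : ℝ) (u v : Lp ℝ 2 (μ.prod (volume.restrict (Ioo 0 T)))),
      (hmem (r • u + s • v)).toLp _ = r • (hmem u).toLp _ + s • (hmem v).toLp _ := by
    intro r s u v
    refine Lp.ext ?_
    filter_upwards [(hmem (r • u + s • v)).coeFn_toLp, (hmem u).coeFn_toLp, (hmem v).coeFn_toLp,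
      Lp.coeFn_linear_comb r s ((hmem u).toLp _) ((hmem v).toLp _),
      volterra_congr_ae (Lp.coeFn_linear_comb r s u v),
      volterra_linear_comb_ae (Lp.memLp u) (Lp.memLp v) r s] with p h₁ h₂ h₃ h₄ h₅ h₆
    rw [h₁, h₄, h₂, h₃, h₅, h₆]
  refine ⟨LinearMap.mkContinuous
    { toFun := fun u => (hmem u).toLp _
      map_add' := fun u v => by simpa using key 1 1 u v
      map_smul' := fun r u => by simpa using key r 0 u 0 } |T| fun u => ?_, fun u g hg => ?_⟩
  · simp only [LinearMap.coe_mk, AddHom.coe_mk]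
    rw [Lp.norm_toLp, Lp.norm_def, ← abs_abs T, ← ENNReal.toReal_ofReal (abs_nonneg |T|),
      ← ENNReal.toReal_mul, abs_abs]
    refine ENNReal.toReal_mono (ENNReal.mul_ne_top ENNReal.ofReal_ne_top (Lp.memLp u).2.ne) ?_
    exact (eLpNorm_volterra_le (hsm u)).trans
      (mul_le_mul_left (ENNReal.ofReal_le_ofReal (le_abs_self T)) _)
  · exact (hmem u).coeFn_toLp.trans (volterra_congr_ae hg)

end Operators

/-! ### Boundedness of derivatives of functions smooth up to the boundary. -/

section BoundedDerivatives

lemma ContinuousOn.memLp_top_of_isCompact {X : Type*} [TopologicalSpace X]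
    [TopologicalSpace.PseudoMetrizableSpace X] [MeasureSpace X] [BorelSpace X] {F : X → ℝ} {S U : Set X} (hF : ContinuousOn F S)
    (hS : IsCompact S) (hU : IsOpen U) (hUS : U ⊆ S) : MemLp F ⊤ (volume.restrict U) := by
  obtain ⟨C, hC⟩ := hS.exists_bound_of_continuousOn hF
  exact memLp_top_of_bound ((hF.mono hUS).aestronglyMeasurable hU.measurableSet) C
    (ae_restrict_of_forall_mem hU.measurableSet fun p hp => hC p (hUS hp))

variable {V : Type*} [NormedAddCommGroup V] [NormedSpace ℝ V]

/-- A function which is `C^m` up to the boundary on a compact set has bounded derivatives on the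
open subsets. -/
lemma ContDiffOn.exists_bound_iteratedFDeriv {F : V → ℝ} {S U : Set V} {m : ℕ}
    (hF : ContDiffOn ℝ m F S) (hS : IsCompact S) (hU : IsOpen U) (hUS : U ⊆ S) :
    ∃ C : ℝ, ∀ p ∈ U, ‖iteratedFDeriv ℝ m F p‖ ≤ C := by
  suffices h : ∃ C : ℝ, ∀ p ∈ U ∩ S, ‖iteratedFDeriv ℝ m F p‖ ≤ C by
    rwa [inter_eq_left.2 hUS] at h
  refine hS.induction_on (p := fun s => ∃ C : ℝ, ∀ p ∈ U ∩ s, ‖iteratedFDeriv ℝ m F p‖ ≤ C)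
    ⟨0, by simp⟩ ?_ ?_ ?_
  · rintro s t hst ⟨C, hC⟩
    exact ⟨C, fun p hp => hC p ⟨hp.1, hst hp.2⟩⟩
  · rintro s t ⟨C, hC⟩ ⟨C', hC'⟩
    refine ⟨max C C', fun p hp => ?_⟩
    rcases hp.2 with h | h
    · exact (hC p ⟨hp.1, h⟩).trans (le_max_left _ _)
    · exact (hC' p ⟨hp.1, h⟩).trans (le_max_right _ _)
  · intro x hx
    -- Near `x` there is a Taylor series `P` relative to `S`, continuous and so locally bounded. On
    -- the open set `U ∩ O` derivatives are unique, so `P` gives the true ones there, whatever the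
    -- shape of `S` at its boundary.
    obtain ⟨u, hu, P, hP⟩ := contDiffWithinAt_nat.1 (hF x hx)
    rw [insert_eq_of_mem hx] at hu
    have hxu : x ∈ u := mem_of_mem_nhdsWithin hx hu
    have hc : ContinuousWithinAt (fun y => ‖P y m‖) u x := (hP.cont m le_rfl).norm x hxu
    have hb : ∀ᶠ y in 𝓝[u] x, ‖P y m‖ < ‖P x m‖ + 1 :=
      hc.eventually_lt_const (lt_add_one _)
    have hb' : ∀ᶠ y in 𝓝[S] x, y ∈ u ∧ ‖P y m‖ < ‖P x m‖ + 1 := by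
      have h₁ : 𝓝[S] x ≤ 𝓝[u] x := nhdsWithin_le_iff.2 hu
      exact (eventually_of_mem hu fun _ h => h).and (h₁ hb)
    obtain ⟨O, hO, hxO, hOS⟩ := mem_nhdsWithin.1 hb'
    refine ⟨O ∩ S, mem_nhdsWithin.2 ⟨O, hO, hxO, subset_rfl⟩, ‖P x m‖ + 1, fun p hp => ?_⟩
    have hopen : IsOpen (U ∩ O) := hU.inter hO
    have hsub : U ∩ O ⊆ u := fun q hq => (hOS ⟨hq.2, hUS hq.1⟩).1
    have hp' : p ∈ U ∩ O := ⟨hp.1, hp.2.1⟩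
    have e := (hP.mono hsub).eq_iteratedFDerivWithin_of_uniqueDiffOn (m := m) le_rfl
      hopen.uniqueDiffOn hp'
    rw [iteratedFDerivWithin_of_isOpen m hopen hp'] at e
    rw [← e]
    exact (hOS hp.2).2.le

variable [MeasureSpace V] [BorelSpace V]

lemma ContDiffOn.memLp_top_partialDerivs {F : V → ℝ} {S U : Set V} (hF : ContDiffOn ℝ 2 F S)
    (hS : IsCompact S) (hU : IsOpen U) (hUS : U ⊆ S) :
    (∀ v, MemLp (fun p => fderiv ℝ F p v) ⊤ (volume.restrict U)) ∧
      ∀ v w, MemLp (fun p => fderiv ℝ (fderiv ℝ F) p v w) ⊤ (volume.restrict U) := by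
  obtain ⟨C₁, h₁⟩ := (hF.of_le (m := (1 : ℕ)) (by norm_num)).exists_bound_iteratedFDeriv hS hU hUS
  obtain ⟨C₂, h₂⟩ := (hF.of_le (m := (2 : ℕ)) (by norm_num)).exists_bound_iteratedFDeriv hS hU hUS
  have d₁ : ContDiffOn ℝ 1 (fderiv ℝ F) U :=
    (hF.mono hUS).fderiv_of_isOpen hU (by norm_num)
  have d₂ : ContinuousOn (fderiv ℝ (fderiv ℝ F)) U :=
    (d₁.fderiv_of_isOpen (m := 0) hU (by norm_num)).continuousOn
  refine ⟨fun v => memLp_top_of_bound ?_ (C₁ * ‖v‖) ?_, fun v w =>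
    memLp_top_of_bound ?_ (C₂ * ‖v‖ * ‖w‖) ?_⟩
  · exact (d₁.continuousOn.clm_apply continuousOn_const).aestronglyMeasurable hU.measurableSet
  · refine ae_restrict_of_forall_mem hU.measurableSet fun p hp => ?_
    refine (ContinuousLinearMap.le_opNorm _ _).trans ?_
    gcongr
    simpa using h₁ p hp
  · exact ((d₂.clm_apply continuousOn_const).clm_apply continuousOn_const).aestronglyMeasurable
      hU.measurableSet
  · refine ae_restrict_of_forall_mem hU.measurableSet fun p hp => ?_
    refine (ContinuousLinearMap.le_opNorm₂ _ _ _).trans ?_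
    gcongr
    rw [← norm_iteratedFDeriv_one, norm_iteratedFDeriv_fderiv]
    exact h₂ p hp

end BoundedDerivatives

/-! ### Derivatives of time and space slices as partial derivatives. -/

section Slices

variable {V W : Type*} [NormedAddCommGroup V] [NormedSpace ℝ V] [NormedAddCommGroup W]
  [NormedSpace ℝ W]

lemma fderiv_comp_affine {F : V → ℝ} {ι : W → V} {A : W →L[ℝ] V} {y : W}
    (hι : HasFDerivAt ι A y) (hF : DifferentiableAt ℝ F (ι y)) :
    fderiv ℝ (fun z => F (ι z)) y = (fderiv ℝ F (ι y)).comp A :=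
  (hF.hasFDerivAt.comp y hι).fderiv

/-- The derivative of `ι` is the constant `A`, so the second-order chain rule has no term in the
second derivative of `ι`. -/
lemma fderiv_fderiv_comp_affine {F : V → ℝ} {ι : W → V} {A : W →L[ℝ] V} {y : W}
    (hι : ∀ z, HasFDerivAt ι A z) (hF : ContDiffAt ℝ 2 F (ι y)) (v w : W) :
    fderiv ℝ (fderiv ℝ fun z => F (ι z)) y v w = fderiv ℝ (fderiv ℝ F) (ι y) (A v) (A w) := by
  have h₁ : ∀ᶠ z in 𝓝 y, fderiv ℝ (fun z => F (ι z)) z = (fderiv ℝ F (ι z)).comp A := by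
    have h₂ : ∀ᶠ p in 𝓝 (ι y), ContDiffAt ℝ 2 F p := hF.eventually (by simp)
    filter_upwards [(hι y).continuousAt.eventually h₂] with z hz
    exact fderiv_comp_affine (hι z) (hz.differentiableAt (by simp))
  have h₃ : HasFDerivAt (fderiv ℝ F) (fderiv ℝ (fderiv ℝ F) (ι y)) (ι y) :=
    ((hF.fderiv_right (m := 1) (by norm_num)).differentiableAt (by simp)).hasFDerivAt
  have h₄ := ((ContinuousLinearMap.compL ℝ W V ℝ).flip A).hasFDerivAt.comp y (h₃.comp y (hι y))
  have h₅ : (fderiv ℝ fun z => F (ι z)) =ᶠ[𝓝 y]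
      (ContinuousLinearMap.compL ℝ W V ℝ).flip A ∘ fderiv ℝ F ∘ ι := h₁
  rw [h₅.fderiv_eq, h₄.fderiv]
  rfl

end Slices

section SpaceTimeSlices

variable {d : ℕ} {F : EuclideanSpace ℝ (Fin d) × ℝ → ℝ} {x : EuclideanSpace ℝ (Fin d)} {t : ℝ}

lemma hasFDerivAt_timeSlice (x : EuclideanSpace ℝ (Fin d)) (s : ℝ) :
    HasFDerivAt (fun s : ℝ => (x, s))
      (ContinuousLinearMap.inr ℝ (EuclideanSpace ℝ (Fin d)) ℝ) s :=
  hasFDerivAt_prodMk_right x s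

lemma hasFDerivAt_spaceSlice (t : ℝ) (y : EuclideanSpace ℝ (Fin d)) :
    HasFDerivAt (fun y => (y, t))
      (ContinuousLinearMap.inl ℝ (EuclideanSpace ℝ (Fin d)) ℝ) y :=
  hasFDerivAt_prodMk_left y t

lemma deriv_timeSlice (hF : DifferentiableAt ℝ F (x, t)) :
    deriv (fun s => F (x, s)) t = fderiv ℝ F (x, t) (0, 1) := by
  rw [← fderiv_apply_one_eq_deriv, fderiv_comp_affine (hasFDerivAt_timeSlice x t) hF]
  rfl

lemma iteratedDeriv_two_timeSlice (hF : ContDiffAt ℝ 2 F (x, t)) :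
    iteratedDeriv 2 (fun s => F (x, s)) t = fderiv ℝ (fderiv ℝ F) (x, t) (0, 1) (0, 1) := by
  rw [iteratedDeriv_eq_iteratedFDeriv, iteratedFDeriv_two_apply,
    fderiv_fderiv_comp_affine (hasFDerivAt_timeSlice x) hF]
  rfl

lemma gradient_apply (g : EuclideanSpace ℝ (Fin d) → ℝ) (x : EuclideanSpace ℝ (Fin d))
    (i : Fin d) : gradient g x i = fderiv ℝ g x (spaceFrame d i) := by
  rw [← inner_gradient_left]
  simp [spaceFrame, EuclideanSpace.inner_single_right, -inner_gradient_left]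

lemma gradient_spaceSlice (hF : DifferentiableAt ℝ F (x, t)) (i : Fin d) :
    gradient (fun y => F (y, t)) x i = fderiv ℝ F (x, t) (spaceFrame d i, 0) := by
  rw [gradient_apply, fderiv_comp_affine (hasFDerivAt_spaceSlice t x) hF]
  rfl

lemma laplacian_spaceSlice (hF : ContDiffAt ℝ 2 F (x, t)) :
    Laplacian.laplacian (fun y => F (y, t)) x =
      ∑ i, fderiv ℝ (fderiv ℝ F) (x, t) (spaceFrame d i, 0) (spaceFrame d i, 0) := by
  rw [InnerProductSpace.laplacian_eq_iteratedFDeriv_orthonormalBasis _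
    (EuclideanSpace.basisFun (Fin d) ℝ)]
  refine Finset.sum_congr rfl fun i _ => ?_
  rw [iteratedFDeriv_two_apply, fderiv_fderiv_comp_affine (hasFDerivAt_spaceSlice t) hF]
  simp [spaceFrame]

end SpaceTimeSlices

/-! ### Joint measurability of `h_tt`. -/

section Caratheodory

variable {X : Type*} [MeasurableSpace X]

/-- The derivative is the limit of difference quotients with steps `1/(n+1)`, each jointly
measurable. Cutting off at `t > 0` ensures convergence at every point. -/
lemma exists_measurable_deriv {G : X × ℝ → ℝ} (hG : Measurable G)
    (hd : ∀ x, ∀ t, 0 < t → DifferentiableAt ℝ (fun s => G (x, s)) t) :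
    ∃ G' : X × ℝ → ℝ, Measurable G' ∧
      ∀ x, ∀ t, 0 < t → G' (x, t) = deriv (fun s => G (x, s)) t := by
  have hs : MeasurableSet {p : X × ℝ | 0 < p.2} := measurableSet_lt measurable_const measurable_snd
  refine ⟨{p : X × ℝ | 0 < p.2}.indicator fun p => deriv (fun s => G (p.1, s)) p.2, ?_,
    fun x t ht => indicator_of_mem (s := {p : X × ℝ | 0 < p.2}) ht _⟩
  refine measurable_of_tendsto_metrizable (f := fun (n : ℕ) =>
    {p : X × ℝ | 0 < p.2}.indicator fun p : X × ℝ =>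
      (1 / ((n : ℝ) + 1))⁻¹ • (G (p.1, p.2 + 1 / ((n : ℝ) + 1)) - G (p.1, p.2))) (fun n => ?_) ?_
  · refine Measurable.indicator (Measurable.fun_const_smul (Measurable.sub ?_ ?_) _) hs
    · exact hG.comp (measurable_fst.prodMk (measurable_snd.add_const _))
    · exact hG
  · refine tendsto_pi_nhds.2 fun p => ?_
    by_cases hp : 0 < p.2
    · have hmem : p ∈ {p : X × ℝ | 0 < p.2} := hp
      simp only [indicator_of_mem hmem]
      refine (hd p.1 p.2 hp).hasDerivAt.tendsto_slope_zero.comp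
        (f := fun n : ℕ => 1 / ((n : ℝ) + 1)) ?_
      exact tendsto_nhdsWithin_iff.2 ⟨tendsto_one_div_add_atTop_nhds_zero_nat,
        Eventually.of_forall fun n => by simp only [mem_compl_iff, mem_singleton_iff]; positivity⟩
    · have hmem : p ∉ {p : X × ℝ | 0 < p.2} := hp
      simp only [indicator_of_notMem hmem]
      exact tendsto_const_nhds

/-- Regularity of `h` is known only in each variable separately. Measurability in `x` and continuity
in `t` make `h` a Carathéodory function, hence jointly measurable for `t > 0`; two rounds of
difference quotients then reach `h_tt`. -/
lemma exists_measurable_iteratedDeriv_two {h : X → ℝ → ℝ}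
    (hx : ∀ t, 0 < t → Measurable fun x => h x t) (ht : ∀ x, ContDiffOn ℝ 2 (h x) (Ici 0)) :
    ∃ G : X × ℝ → ℝ, Measurable G ∧ ∀ x, ∀ t, 0 < t → G (x, t) = iteratedDeriv 2 (h x) t := by
  have hat : ∀ x, ∀ t, 0 < t → ContDiffAt ℝ 2 (h x) t := fun x t h0 =>
    (ht x).contDiffAt (Ici_mem_nhds h0)
  -- The substitution `t = exp s` turns the half-line into all of `ℝ`, where the Carathéodory
  -- criterion asks for continuity.
  have hu : StronglyMeasurable (Function.uncurry fun (s : ℝ) (x : X) => h x (Real.exp s)) := by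
    refine stronglyMeasurable_uncurry_of_continuous_of_stronglyMeasurable (fun x => ?_)
      fun s => (hx _ (Real.exp_pos s)).stronglyMeasurable
    exact continuous_iff_continuousAt.2 fun s =>
      (hat x _ (Real.exp_pos s)).continuousAt.comp Real.continuous_exp.continuousAt
  have hH : Measurable fun p : X × ℝ => h p.1 (Real.exp (Real.log p.2)) :=
    hu.measurable.comp ((Real.measurable_log.comp measurable_snd).prodMk measurable_fst)
  have hev : ∀ x, ∀ t, 0 < t → (fun s => h x (Real.exp (Real.log s))) =ᶠ[𝓝 t] h x := by
    intro x t h0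
    filter_upwards [Ioi_mem_nhds h0] with s hs
    rw [Real.exp_log hs]
  obtain ⟨G₁, hG₁, e₁⟩ := exists_measurable_deriv hH fun x t h0 =>
    ((hat x t h0).differentiableAt (by simp)).congr_of_eventuallyEq (hev x t h0)
  have hev₁ : ∀ x, ∀ t, 0 < t → (fun s => G₁ (x, s)) =ᶠ[𝓝 t] deriv (h x) := by
    intro x t h0
    filter_upwards [Ioi_mem_nhds h0] with s hs
    rw [e₁ x s hs, (hev x s hs).deriv_eq]
  have hd : ∀ x, ∀ t, 0 < t → DifferentiableAt ℝ (deriv (h x)) t := by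
    intro x t h0
    have := (((hat x t h0).fderiv_right (m := 1) (by norm_num)).differentiableAt
      (by simp)).clm_apply (differentiableAt_const (1 : ℝ))
    simpa only [fderiv_apply_one_eq_deriv] using this
  obtain ⟨G₂, hG₂, e₂⟩ := exists_measurable_deriv hG₁ fun x t h0 =>
    (hd x t h0).congr_of_eventuallyEq (hev₁ x t h0)
  refine ⟨G₂, hG₂, fun x t h0 => ?_⟩
  rw [e₂ x t h0, (hev₁ x t h0).deriv_eq, iteratedDeriv_succ, iteratedDeriv_one]

end Caratheodory

/-! ### Calculus of bounded operators on jets. -/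

section JetOperators

variable {V : Type*} [NormedAddCommGroup V] [NormedSpace ℝ V] [MeasureSpace V] {n k : ℕ}
  {b : Fin n → V} {U : Set V}

/-- An operator on `H^k(U)` which is the restriction of a bounded operator on the families of weak
derivatives, with values in `L²(U)`. -/
def IsJetOperator (b : Fin n → V) (k : ℕ) (U : Set V) (P : (V → ℝ) → V → ℝ) : Prop :=
  ∃ A : JetSpace n k U →L[ℝ] Lp ℝ 2 ((volume : Measure V).restrict U),
    ∀ (w : Lp ℝ 2 ((volume : Measure V).restrict U)) (y : JetSpace n k U),
      (∀ β : multiIndices n k, y β =ᵐ[volume.restrict U] weakDeriv b β U w) →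
        A y =ᵐ[volume.restrict U] P w

lemma isJetOperator_weakDeriv {α : Fin n → ℕ} (hα : ∑ i, α i ≤ k) :
    IsJetOperator b k U fun w => weakDeriv b α U w :=
  ⟨PiLp.proj 2 _ (⟨α, mem_multiIndices.2 hα⟩ : multiIndices n k), fun _ _ hy => hy ⟨α, mem_multiIndices.2 hα⟩⟩

lemma isJetOperator_zero : IsJetOperator b k U fun _ _ => 0 :=
  ⟨0, fun _ _ _ => Lp.coeFn_zero _ _ _⟩

lemma IsJetOperator.add {P Q : (V → ℝ) → V → ℝ} (hP : IsJetOperator b k U P)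
    (hQ : IsJetOperator b k U Q) : IsJetOperator b k U fun w p => P w p + Q w p := by
  obtain ⟨A, hA⟩ := hP
  obtain ⟨A', hA'⟩ := hQ
  refine ⟨A + A', fun w y hy => ?_⟩
  filter_upwards [Lp.coeFn_add (A y) (A' y), hA w y hy, hA' w y hy] with p h₁ h₂ h₃
  rw [_root_.add_apply, h₁, Pi.add_apply, h₂, h₃]

lemma IsJetOperator.mul {P : (V → ℝ) → V → ℝ} {m : V → ℝ} (hP : IsJetOperator b k U P)
    (hm : MemLp m ⊤ (volume.restrict U)) : IsJetOperator b k U fun w p => m p * P w p := by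
  obtain ⟨A, hA⟩ := hP
  obtain ⟨M, hM⟩ := exists_clm_mul hm
  refine ⟨M ∘L A, fun w y hy => ?_⟩
  filter_upwards [hM (A y), hA w y hy] with p h₁ h₂
  rw [ContinuousLinearMap.comp_apply, h₁, h₂]

lemma IsJetOperator.neg {P : (V → ℝ) → V → ℝ} (hP : IsJetOperator b k U P) :
    IsJetOperator b k U fun w p => -P w p := by
  simpa using hP.mul (m := fun _ => -1) (memLp_top_const _)

lemma IsJetOperator.sub {P Q : (V → ℝ) → V → ℝ} (hP : IsJetOperator b k U P)
    (hQ : IsJetOperator b k U Q) : IsJetOperator b k U fun w p => P w p - Q w p := by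
  simpa only [sub_eq_add_neg] using hP.add hQ.neg

lemma IsJetOperator.sum {ι : Type*} (s : Finset ι) {P : ι → (V → ℝ) → V → ℝ}
    (hP : ∀ i ∈ s, IsJetOperator b k U (P i)) :
    IsJetOperator b k U fun w p => ∑ i ∈ s, P i w p := by
  classical
  induction s using Finset.induction_on with
  | empty => simpa using isJetOperator_zero
  | insert i s hi ih =>
    simp only [Finset.sum_insert hi]
    exact (hP i (Finset.mem_insert_self i s)).add
      (ih fun j hj => hP j (Finset.mem_insert_of_mem hj))

lemma isJetOperator_id [BorelSpace V] [IsFiniteMeasureOnCompacts (volume : Measure V)]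
    [FiniteDimensional ℝ V] (hU : IsOpen U) : IsJetOperator b k U fun w => w :=
  ⟨PiLp.proj 2 _ (zeroIndex n k), fun w y hy => by
    rw [PiLp.proj_apply, jet_zeroIndex hU hy]⟩

end JetOperators

/-! ### The operator `𝓛` is bounded on jets. -/

section Volterra

variable {d : ℕ} {Ω : Set (EuclideanSpace ℝ (Fin d))} {T : ℝ}

lemma isOpen_cylinder (hΩ : IsOpen Ω) : IsOpen (cylinder Ω T) := hΩ.prod isOpen_Ioo

lemma cylinder_subset : cylinder Ω T ⊆ closure Ω ×ˢ Icc 0 T :=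
  prod_mono subset_closure Ioo_subset_Icc_self

lemma isCompact_closure_cylinder (hb : Bornology.IsBounded Ω) :
    IsCompact (closure Ω ×ˢ Icc 0 T) := hb.isCompact_closure.prod isCompact_Icc

lemma restrict_cylinder : (volume : Measure (EuclideanSpace ℝ (Fin d) × ℝ)).restrict (cylinder Ω T)
    = (volume.restrict Ω).prod (volume.restrict (Ioo 0 T)) := by
  rw [Measure.prod_restrict]
  rfl

lemma isFiniteMeasure_restrict_of_isBounded (hb : Bornology.IsBounded Ω) :
    IsFiniteMeasure ((volume : Measure (EuclideanSpace ℝ (Fin d))).restrict Ω) :=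
  ⟨by simpa using hb.measure_lt_top⟩

lemma isJetOperator_integral_timeDeriv (hb : Bornology.IsBounded Ω) :
    IsJetOperator (spaceTimeFrame d) 3 (cylinder Ω T)
      fun w p => ∫ τ in (0 : ℝ)..p.2, timeDeriv Ω T w (p.1, τ) := by
  have := isFiniteMeasure_restrict_of_isBounded hb
  obtain ⟨A, hA⟩ := isJetOperator_weakDeriv (b := spaceTimeFrame d) (k := 3) (U := cylinder Ω T)
    (α := Pi.single (Fin.last d) 1) (by simp)
  have hW := exists_clm_volterra (μ := volume.restrict Ω) (T := T)
  rw [← restrict_cylinder] at hW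
  obtain ⟨W, hW⟩ := hW
  exact ⟨W ∘L A, fun w y hy => hW (A y) _ (hA w y hy)⟩

lemma memLp_top_comp_fst (hΩ : IsOpen Ω) (hb : Bornology.IsBounded Ω)
    {g : EuclideanSpace ℝ (Fin d) → ℝ} (hg : ContinuousOn g (closure Ω)) :
    MemLp (fun p : EuclideanSpace ℝ (Fin d) × ℝ => g p.1) ⊤ (volume.restrict (cylinder Ω T)) :=
  ContinuousOn.memLp_top_of_isCompact (hg.comp continuousOn_fst fun _ hp => hp.1)
    (isCompact_closure_cylinder hb) (isOpen_cylinder hΩ) cylinder_subset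

section Slices

variable {F : EuclideanSpace ℝ (Fin d) × ℝ → ℝ}

lemma contDiffAt_of_mem_cylinder (hΩ : IsOpen Ω) (hF : ContDiffOn ℝ 2 F (closure Ω ×ˢ Icc 0 T))
    {p : EuclideanSpace ℝ (Fin d) × ℝ} (hp : p ∈ cylinder Ω T) : ContDiffAt ℝ 2 F p :=
  (hF.mono cylinder_subset).contDiffAt ((isOpen_cylinder hΩ).mem_nhds hp)

variable (hΩ : IsOpen Ω) (hb : Bornology.IsBounded Ω)
  (hF : ContDiffOn ℝ 2 F (closure Ω ×ˢ Icc 0 T))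

include hΩ hb hF

lemma memLp_top_deriv_timeSlice : MemLp (fun p : EuclideanSpace ℝ (Fin d) × ℝ =>
    deriv (fun s => F (p.1, s)) p.2) ⊤ (volume.restrict (cylinder Ω T)) :=
  ((hF.memLp_top_partialDerivs (isCompact_closure_cylinder hb) (isOpen_cylinder hΩ)
    cylinder_subset).1 (0, 1)).ae_eq
    (ae_restrict_of_forall_mem (isOpen_cylinder hΩ).measurableSet fun p hp =>
      (deriv_timeSlice ((contDiffAt_of_mem_cylinder hΩ hF hp).differentiableAt (by simp))).symm)

lemma memLp_top_iteratedDeriv_timeSlice : MemLp (fun p : EuclideanSpace ℝ (Fin d) × ℝ =>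
    iteratedDeriv 2 (fun s => F (p.1, s)) p.2) ⊤ (volume.restrict (cylinder Ω T)) :=
  ((hF.memLp_top_partialDerivs (isCompact_closure_cylinder hb) (isOpen_cylinder hΩ)
    cylinder_subset).2 (0, 1) (0, 1)).ae_eq
    (ae_restrict_of_forall_mem (isOpen_cylinder hΩ).measurableSet fun _ hp =>
      (iteratedDeriv_two_timeSlice (contDiffAt_of_mem_cylinder hΩ hF hp)).symm)

lemma memLp_top_gradient_spaceSlice (i : Fin d) :
    MemLp (fun p : EuclideanSpace ℝ (Fin d) × ℝ =>
      gradient (fun y => F (y, p.2)) p.1 i) ⊤ (volume.restrict (cylinder Ω T)) :=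
  ((hF.memLp_top_partialDerivs (isCompact_closure_cylinder hb) (isOpen_cylinder hΩ)
    cylinder_subset).1 (spaceFrame d i, 0)).ae_eq
    (ae_restrict_of_forall_mem (isOpen_cylinder hΩ).measurableSet fun p hp =>
      (gradient_spaceSlice
        ((contDiffAt_of_mem_cylinder hΩ hF hp).differentiableAt (by simp)) i).symm)

lemma memLp_top_laplacian_spaceSlice : MemLp (fun p : EuclideanSpace ℝ (Fin d) × ℝ =>
    Laplacian.laplacian (fun y => F (y, p.2)) p.1) ⊤ (volume.restrict (cylinder Ω T)) :=
  (memLp_finsetSum Finset.univ fun i _ =>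
    (hF.memLp_top_partialDerivs (isCompact_closure_cylinder hb) (isOpen_cylinder hΩ)
      cylinder_subset).2 (spaceFrame d i, 0) (spaceFrame d i, 0)).ae_eq
    (ae_restrict_of_forall_mem (isOpen_cylinder hΩ).measurableSet fun _ hp =>
      (laplacian_spaceSlice (contDiffAt_of_mem_cylinder hΩ hF hp)).symm)

end Slices

lemma MeasureTheory.MemLp.fun_mul_top {X : Type*} [MeasurableSpace X] {μ : Measure X} {f g : X → ℝ} {p : ℝ≥0∞}
    (hf : MemLp f ⊤ μ) (hg : MemLp g p μ) : MemLp (fun x => f x * g x) p μ :=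
  MemLp.mul hg hf

lemma MeasureTheory.MemLp.div_of_one_div {X : Type*} [MeasurableSpace X] {μ : Measure X}
    {f g : X → ℝ} {p : ℝ≥0∞} (hf : MemLp f p μ) (hg : MemLp (fun x => 1 / g x) ⊤ μ) :
    MemLp (fun x => f x / g x) p μ := by
  convert hg.fun_mul_top hf using 2 with x
  ring

section LowerOrder

variable {c a : EuclideanSpace ℝ (Fin d) → ℝ}
  {B : EuclideanSpace ℝ (Fin d) → EuclideanSpace ℝ (Fin d)}
  {h k : EuclideanSpace ℝ (Fin d) → ℝ → ℝ}

/-- `L` is linear in `(z, q, r)`, so its coefficients are its values at unit vectors; this exhibits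
it as a sum of multiplication operators applied to `w`, `∇w` and `w_t`. Division enters only as
multiplication by an inverse, so `k x t ≠ 0` is not needed. -/
lemma lowerOrder_linear (x : EuclideanSpace ℝ (Fin d)) (t z : ℝ) (q : EuclideanSpace ℝ (Fin d))
    (r : ℝ) : lowerOrder c a B h k x t z q r =
      lowerOrder c a B h k x t 1 0 0 * z
        + ∑ i, lowerOrder c a B h k x t 0 (spaceFrame d i) 0 * q i
        + lowerOrder c a B h k x t 0 0 1 * r := by
  have hs : ∀ u : EuclideanSpace ℝ (Fin d), inner ℝ u q = ∑ i, u i * q i := by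
    intro u
    rw [PiLp.inner_apply]
    exact Finset.sum_congr rfl fun i _ => by simp [mul_comm]
  have hq : ∑ i, lowerOrder c a B h k x t 0 (spaceFrame d i) 0 * q i
      = k x t * inner ℝ (B x) q / k x t
        - 2 * (k x t * inner ℝ (gradient (fun y => 1 / k y t) x) q) := by
    rw [hs, hs, Finset.mul_sum, Finset.mul_sum, Finset.mul_sum, Finset.sum_div,
      ← Finset.sum_sub_distrib]
    refine Finset.sum_congr rfl fun i _ => ?_
    simp only [lowerOrder, spaceFrame, inner_smul_right, EuclideanSpace.inner_single_right,
      inner_add_right]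
    simp
    ring
  rw [hq]
  simp only [lowerOrder, inner_smul_right, inner_add_right, inner_zero_right]
  ring

variable (hΩ : IsOpen Ω) (hb : Bornology.IsBounded Ω)
  (hc : Continuous c) (ha : Continuous a) (hB : Continuous B)
  (hh : MemLp (fun p : EuclideanSpace ℝ (Fin d) × ℝ => iteratedDeriv 2 (h p.1) p.2) ⊤
    (volume.restrict (cylinder Ω T)))
  (hk : ContDiffOn ℝ 2 (fun p : EuclideanSpace ℝ (Fin d) × ℝ => k p.1 p.2)
      (closure Ω ×ˢ Icc 0 T))
  (hk_ne : ∀ x ∈ closure Ω, ∀ t ∈ Icc 0 T, k x t ≠ 0)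

include hΩ hb hk hk_ne

lemma memLp_top_one_div : MemLp (fun p : EuclideanSpace ℝ (Fin d) × ℝ => 1 / k p.1 p.2) ⊤
    (volume.restrict (cylinder Ω T)) :=
  (contDiffOn_const.div hk fun p hp => hk_ne p.1 hp.1 p.2 hp.2).continuousOn.memLp_top_of_isCompact
    (isCompact_closure_cylinder hb) (isOpen_cylinder hΩ) cylinder_subset

include hc ha hB hh

/-- For fixed `(z, q, r)` only coefficients remain: `a`, `B`, `c` are continuous on the compact
closure, `k` and `1 / k` are `C²` up to the boundary, and `h_tt` is bounded. -/
lemma memLp_top_lowerOrder (z : ℝ) (q : EuclideanSpace ℝ (Fin d)) (r : ℝ) :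
    MemLp (fun p : EuclideanSpace ℝ (Fin d) × ℝ => lowerOrder c a B h k p.1 p.2 z q r) ⊤
      (volume.restrict (cylinder Ω T)) := by
  have hρ : ContDiffOn ℝ 2 (fun p : EuclideanSpace ℝ (Fin d) × ℝ => 1 / k p.1 p.2)
      (closure Ω ×ˢ Icc 0 T) := contDiffOn_const.div hk fun p hp => hk_ne p.1 hp.1 p.2 hp.2
  have mk := hk.continuousOn.memLp_top_of_isCompact
    (isCompact_closure_cylinder hb) (isOpen_cylinder hΩ) cylinder_subset
  have mρ := memLp_top_one_div hΩ hb hk hk_ne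
  have mc := memLp_top_comp_fst (T := T) hΩ hb hc.continuousOn
  have ma := memLp_top_comp_fst (T := T) hΩ hb ha.continuousOn
  have mB : ∀ i, MemLp (fun p : EuclideanSpace ℝ (Fin d) × ℝ => B p.1 i) ⊤
      (volume.restrict (cylinder Ω T)) := fun i =>
    memLp_top_comp_fst (T := T) hΩ hb (g := fun x => B x i)
      ((PiLp.continuous_apply 2 _ i).comp hB).continuousOn
  have mq : ∀ i, MemLp (fun p : EuclideanSpace ℝ (Fin d) × ℝ =>
      k p.1 p.2 * q i + z * gradient (fun y => k y p.2) p.1 i) ⊤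
      (volume.restrict (cylinder Ω T)) := fun i =>
    (mk.fun_mul_top (memLp_top_const (q i))).add
      ((memLp_top_gradient_spaceSlice hΩ hb hk i).const_mul z)
  have mr : MemLp (fun p : EuclideanSpace ℝ (Fin d) × ℝ =>
      k p.1 p.2 * r + deriv (k p.1) p.2 * z) ⊤ (volume.restrict (cylinder Ω T)) :=
    (mk.fun_mul_top (memLp_top_const r)).add
      ((memLp_top_deriv_timeSlice hΩ hb hk).fun_mul_top (memLp_top_const z))
  have m₁ : MemLp (fun p : EuclideanSpace ℝ (Fin d) × ℝ => inner ℝ (B p.1)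
      (k p.1 p.2 • q + z • gradient (fun y => k y p.2) p.1)) ⊤
      (volume.restrict (cylinder Ω T)) := by
    simp only [PiLp.inner_apply]
    exact memLp_finsetSum _ fun i _ => (mq i).fun_mul_top (mB i)
  have m₂ : MemLp (fun p : EuclideanSpace ℝ (Fin d) × ℝ =>
      inner ℝ (gradient (fun y => 1 / k y p.2) p.1)
      (k p.1 p.2 • q + z • gradient (fun y => k y p.2) p.1)) ⊤
      (volume.restrict (cylinder Ω T)) := by
    simp only [PiLp.inner_apply]
    exact memLp_finsetSum _ fun i _ =>
      (mq i).fun_mul_top (memLp_top_gradient_spaceSlice hΩ hb hρ i)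
  have m₃ : MemLp (fun p : EuclideanSpace ℝ (Fin d) × ℝ =>
      (a p.1 * k p.1 p.2 * z + inner ℝ (B p.1)
      (k p.1 p.2 • q + z • gradient (fun y => k y p.2) p.1)) / k p.1 p.2) ⊤
      (volume.restrict (cylinder Ω T)) :=
    (((ma.fun_mul_top mk).fun_mul_top (memLp_top_const z)).add m₁).div_of_one_div mρ
  have m₄ : MemLp (fun p : EuclideanSpace ℝ (Fin d) × ℝ =>
      c p.1 * (iteratedDeriv 2 (fun s => 1 / k p.1 s) p.2 * k p.1 p.2
        + iteratedDeriv 2 (h p.1) p.2 / k p.1 p.2) * z) ⊤ (volume.restrict (cylinder Ω T)) :=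
    (mc.fun_mul_top (((memLp_top_iteratedDeriv_timeSlice hΩ hb hρ).fun_mul_top mk).add
      (hh.div_of_one_div mρ))).fun_mul_top (memLp_top_const z)
  exact (((m₃.add m₄).add (((mc.const_mul 2).fun_mul_top
    (memLp_top_deriv_timeSlice hΩ hb hρ)).fun_mul_top mr)).sub
    (((memLp_top_laplacian_spaceSlice hΩ hb hρ).fun_mul_top mk).fun_mul_top
      (memLp_top_const z))).sub (m₂.const_mul 2)

lemma isJetOperator_volterraOp :
    IsJetOperator (spaceTimeFrame d) 3 (cylinder Ω T) (volterraOp Ω T c a B h k) := by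
  have mc := memLp_top_comp_fst (T := T) hΩ hb hc.continuousOn
  have mρ := memLp_top_one_div hΩ hb hk hk_ne
  have mL := memLp_top_lowerOrder hΩ hb hc ha hB hh hk hk_ne
  have mI : MemLp (fun p : EuclideanSpace ℝ (Fin d) × ℝ =>
      c p.1 * iteratedDeriv 2 (h p.1) p.2 / k p.1 p.2) ⊤ (volume.restrict (cylinder Ω T)) :=
    (mc.fun_mul_top hh).div_of_one_div mρ
  have hD : ∀ (i : Fin (d + 1)) (m : ℕ), m ≤ 3 → IsJetOperator (spaceTimeFrame d) 3
      (cylinder Ω T) fun w => weakDeriv (spaceTimeFrame d) (Pi.single i m) (cylinder Ω T) w :=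
    fun i m hm => isJetOperator_weakDeriv (by simpa using hm)
  have hlow : IsJetOperator (spaceTimeFrame d) 3 (cylinder Ω T) fun w p =>
      lowerOrder c a B h k p.1 p.2 (w p) (spaceGrad Ω T w p) (timeDeriv Ω T w p) := by
    refine Eq.mp (congrArg _ (funext₂ fun w p => (lowerOrder_linear _ _ _ _ _).symm)) ?_
    exact (((isJetOperator_id (isOpen_cylinder hΩ)).mul (mL 1 0 0)).add
      (IsJetOperator.sum _ fun i _ => (hD i.castSucc 1 (by norm_num)).mul
        (mL 0 (spaceFrame d i) 0))).add ((hD (Fin.last d) 1 (by norm_num)).mul (mL 0 0 1))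
  exact ((((hD (Fin.last d) 2 (by norm_num)).mul mc).sub
    (IsJetOperator.sum _ fun i _ => hD i.castSucc 2 (by norm_num))).sub hlow).add
    ((isJetOperator_integral_timeDeriv hb).mul mI)

end LowerOrder

end Volterra

/-! ### The right-hand side `𝓕` is in `L²(Q)`. -/

section RightHandSide

variable {d : ℕ} {Ω : Set (EuclideanSpace ℝ (Fin d))} {T : ℝ}

lemma memLp_top_iteratedDeriv_two {h : EuclideanSpace ℝ (Fin d) → ℝ → ℝ} (hΩ : IsOpen Ω)
    (hx : ∀ t, 0 < t → Continuous fun x => h x t) (ht : ∀ x, ContDiffOn ℝ 2 (h x) (Ici 0))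
    {M : ℝ} (hM : ∀ x ∈ Ω, ∀ t ∈ Ioo 0 T, |iteratedDeriv 2 (h x) t| ≤ M) :
    MemLp (fun p : EuclideanSpace ℝ (Fin d) × ℝ => iteratedDeriv 2 (h p.1) p.2) ⊤
      (volume.restrict (cylinder Ω T)) := by
  have hmeas := (isOpen_cylinder (T := T) hΩ).measurableSet
  obtain ⟨G, hG, e⟩ := exists_measurable_iteratedDeriv_two (fun t h0 => (hx t h0).measurable) ht
  refine memLp_top_of_bound ⟨G, hG.stronglyMeasurable,
    ae_restrict_of_forall_mem hmeas fun p hp => (e p.1 p.2 hp.2.1).symm⟩ M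
    (ae_restrict_of_forall_mem hmeas fun p hp => hM p.1 hp.1 p.2 hp.2)

lemma memLp_comp_fst_cylinder {g : EuclideanSpace ℝ (Fin d) → ℝ}
    (hg : MemLp g 2 (volume.restrict univ)) :
    MemLp (fun p : EuclideanSpace ℝ (Fin d) × ℝ => g p.1) 2 (volume.restrict (cylinder Ω T)) := by
  rw [restrict_cylinder]
  exact (hg.mono_measure (Measure.restrict_mono (subset_univ Ω) le_rfl)).comp_fst _

lemma memLp_volterraRhs {a : EuclideanSpace ℝ (Fin d) → ℝ}
    {B : EuclideanSpace ℝ (Fin d) → EuclideanSpace ℝ (Fin d)}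
    {h k : EuclideanSpace ℝ (Fin d) → ℝ → ℝ} {f : EuclideanSpace ℝ (Fin d) → ℝ}
    (hΩ : IsOpen Ω) (hb : Bornology.IsBounded Ω) (hT : 0 < T)
    (ha : Continuous a) (hB : Continuous B) (hf : MemHk (spaceFrame d) 2 univ f)
    (hh : MemLp (fun p : EuclideanSpace ℝ (Fin d) × ℝ => iteratedDeriv 2 (h p.1) p.2) ⊤
      (volume.restrict (cylinder Ω T)))
    (hk : ContDiffOn ℝ 2 (fun p : EuclideanSpace ℝ (Fin d) × ℝ => k p.1 p.2)
      (closure Ω ×ˢ Icc 0 T))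
    (hk_ne : ∀ x ∈ closure Ω, ∀ t ∈ Icc 0 T, k x t ≠ 0) (hk_zero : ∀ x ∈ Ω, k x 0 = h x 0) :
    MemLp (volterraRhs a B h k f) 2 (volume.restrict (cylinder Ω T)) := by
  have h0 : (0 : ℝ) ∈ Icc 0 T := ⟨le_rfl, hT.le⟩
  have ma := memLp_top_comp_fst (T := T) hΩ hb ha.continuousOn
  have mB : ∀ i, MemLp (fun p : EuclideanSpace ℝ (Fin d) × ℝ => B p.1 i) ⊤
      (volume.restrict (cylinder Ω T)) := fun i =>
    memLp_top_comp_fst (T := T) hΩ hb (g := fun x => B x i)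
      ((PiLp.continuous_apply 2 _ i).comp hB).continuousOn
  have mρ := memLp_top_one_div hΩ hb hk hk_ne
  -- On `Ω` the initial value `h(x, 0)` equals `k x 0`, which is continuous and nonzero on the
  -- compact closure; this is what bounds `1 / h(x, 0)`.
  have mρ₀ : MemLp (fun p : EuclideanSpace ℝ (Fin d) × ℝ => 1 / h p.1 0) ⊤
      (volume.restrict (cylinder Ω T)) := by
    refine (memLp_top_comp_fst (T := T) hΩ hb (g := fun x => 1 / k x 0) ?_).ae_eq ?_
    · refine continuousOn_const.div ?_ fun x hx => hk_ne x hx 0 h0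
      exact hk.continuousOn.comp (by fun_prop : Continuous fun x => (x, (0 : ℝ))).continuousOn
        fun x hx => ⟨hx, h0⟩
    · exact ae_restrict_of_forall_mem (isOpen_cylinder hΩ).measurableSet fun p hp => by
        simp only [hk_zero p.1 hp.1]
  have hD : ∀ (i : Fin d) (m : ℕ), m ≤ 2 → MemLp (fun p : EuclideanSpace ℝ (Fin d) × ℝ =>
      weakDeriv (spaceFrame d) (Pi.single i m) univ f p.1) 2 (volume.restrict (cylinder Ω T)) :=
    fun i m hm => memLp_comp_fst_cylinder (hf.weakDeriv_spec (by simpa using hm)).1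
  have hsum := ((memLp_finsetSum Finset.univ fun i _ => hD i 2 le_rfl).add
    (ma.fun_mul_top (memLp_comp_fst_cylinder hf.1))).add
    (memLp_finsetSum Finset.univ fun i _ => (mB i).fun_mul_top (hD i 1 (by norm_num)))
  have := ((hh.fun_mul_top hsum).neg.div_of_one_div mρ₀).div_of_one_div mρ
  refine this.ae_eq (ae_of_all _ fun p => ?_)
  simp only [volterraRhs, div_div]
  rfl

end RightHandSide

/-! ### The constraint set is convex and closed under `H³` limits. -/

section ConstraintSet

variable {d : ℕ} {Ω : Set (EuclideanSpace ℝ (Fin d))} {T : ℝ}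
  {Ψ : EuclideanSpace ℝ (Fin d) → ℝ} {ζ ξ : EuclideanSpace ℝ (Fin d) × ℝ → ℝ}

lemma convex_constraintSet (hΩ : IsOpen Ω) : Convex ℝ (constraintSet Ω T Ψ ζ ξ) := by
  rintro u ⟨hu, hu₁, hu₂, hu₃⟩ v ⟨hv, hv₁, hv₂, hv₃⟩ s t - - hst
  have hQ := isOpen_cylinder (T := T) hΩ
  have e := (Lp.coeFn_linear_comb s t u v).symm
  have key : ∀ {k : ℕ} {σ : Measure (EuclideanSpace ℝ (Fin d) × ℝ)}
      {𝓑 : (EuclideanSpace ℝ (Fin d) × ℝ → ℝ) → EuclideanSpace ℝ (Fin d) × ℝ → ℝ}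
      {z : EuclideanSpace ℝ (Fin d) × ℝ → ℝ}, IsLinearOnSmooth 𝓑 → k ≤ 3 →
      HasTrace (spaceTimeFrame d) k (cylinder Ω T) σ 𝓑 u z →
      HasTrace (spaceTimeFrame d) k (cylinder Ω T) σ 𝓑 v z →
      HasTrace (spaceTimeFrame d) k (cylinder Ω T) σ 𝓑 (s • u + t • v : SpaceTimeL2 Ω T) z := by
    intro k σ 𝓑 z h𝓑 hk h h'
    have := (h.linear_comb hQ h𝓑 hu hv hk h' s t).congr hQ (hu.linear_comb hv s t) hk e
    -- The combination has trace `s z + t z`, which is the prescribed `z` because `s + t = 1`.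
    simpa only [← add_mul, hst, one_mul] using this
  exact ⟨(hu.linear_comb hv s t).congr e,
    key (isLinearOnSmooth_fderiv fun _ => (0, 1)) (by norm_num) hu₁ hv₁,
    key isLinearOnSmooth_id (by norm_num) hu₂ hv₂,
    key (isLinearOnSmooth_fderiv fun p => (outerNormal Ω p.1, 0)) (by norm_num) hu₃ hv₃⟩

lemma mem_constraintSet_of_tendsto {w : ℕ → SpaceTimeL2 Ω T} {v : SpaceTimeL2 Ω T}
    (hw : ∀ j, w j ∈ constraintSet Ω T Ψ ζ ξ)
    (hv : MemHk (spaceTimeFrame d) 3 (cylinder Ω T) v)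
    (hlim : ∀ α : Fin (d + 1) → ℕ, ∑ i, α i ≤ 3 → Tendsto (fun j => eLpNorm (fun x =>
      weakDeriv (spaceTimeFrame d) α (cylinder Ω T) (w j) x
        - weakDeriv (spaceTimeFrame d) α (cylinder Ω T) v x) 2 (volume.restrict (cylinder Ω T)))
      atTop (𝓝 0)) : v ∈ constraintSet Ω T Ψ ζ ξ :=
  ⟨hv,
    .of_tendsto (fun j => (hw j).1) hv (by norm_num) (fun j => (hw j).2.1)
      fun α hα => hlim α (hα.trans (by norm_num)),
    .of_tendsto (fun j => (hw j).1) hv (by norm_num) (fun j => (hw j).2.2.1)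
      fun α hα => hlim α (hα.trans (by norm_num)),
    .of_tendsto (fun j => (hw j).1) hv (by norm_num) (fun j => (hw j).2.2.2)
      fun α hα => hlim α (hα.trans (by norm_num))⟩

end ConstraintSet

/-- Here `k` is the auxiliary function `h̃`, and `K = constraintSet Ω T Ψ ζ ξ`. -/
theorem proposition4p1 (d : ℕ) (hd : 2 ≤ d)
    (Ω : Set (EuclideanSpace ℝ (Fin d))) (hΩ : IsPiecewiseSmoothDomain Ω)
    (T : ℝ) (hT : 0 < T)
    (c a : EuclideanSpace ℝ (Fin d) → ℝ)
    (B : EuclideanSpace ℝ (Fin d) → EuclideanSpace ℝ (Fin d))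
    (hc : ContDiff ℝ (((d + 1) / 2 + 3 : ℕ) : WithTop ℕ∞) c)
    (ha : ContDiff ℝ (((d + 1) / 2 + 3 : ℕ) : WithTop ℕ∞) a)
    (hB : ContDiff ℝ (((d + 1) / 2 + 3 : ℕ) : WithTop ℕ∞) B)
    (hc_supp : HasCompactSupport fun x => c x - 1)
    (ha_supp : HasCompactSupport a) (hB_supp : HasCompactSupport B)
    (f : EuclideanSpace ℝ (Fin d) → ℝ)
    (hf : MemHk (spaceFrame d) ((d + 1) / 2 + 5) univ f) (hf_supp : HasCompactSupport f)
    (h : EuclideanSpace ℝ (Fin d) → ℝ → ℝ)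
    (hh_space : ∀ t, 0 < t →
      ContDiff ℝ (((d + 1) / 2 + 1 : ℕ) : WithTop ℕ∞) fun x => h x t)
    (hh_time : ∀ x, ContDiffOn ℝ 3 (h x) (Ici 0))
    (hh_bdd : ∃ M : ℝ, ∀ x ∈ Ω, ∀ t ∈ Ioo 0 T, |iteratedDeriv 2 (h x) t| ≤ M)
    (k : EuclideanSpace ℝ (Fin d) → ℝ → ℝ)
    (hk : ContDiffOn ℝ 2 (fun p : EuclideanSpace ℝ (Fin d) × ℝ => k p.1 p.2)
      (closure Ω ×ˢ Icc 0 T))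
    (hk_ne : ∀ x ∈ closure Ω, ∀ t ∈ Icc 0 T, k x t ≠ 0)
    (hk_zero : ∀ x ∈ Ω, k x 0 = h x 0)
    (hk_deriv : ∀ x ∈ Ω, derivWithin (k x) (Icc 0 T) 0 = derivWithin (h x) (Ici 0) 0)
    (Ψ : EuclideanSpace ℝ (Fin d) → ℝ) (ζ ξ : EuclideanSpace ℝ (Fin d) × ℝ → ℝ)
    (hK : (constraintSet Ω T Ψ ζ ξ).Nonempty)
    (α : ℝ) (hα : 0 < α) :
    (∀ w ∈ constraintSet Ω T Ψ ζ ξ, quasiReversibility Ω T c a B h k f α w < ⊤) ∧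
    ∃! w : SpaceTimeL2 Ω T, w ∈ constraintSet Ω T Ψ ζ ξ ∧
      ∀ v ∈ constraintSet Ω T Ψ ζ ξ,
        quasiReversibility Ω T c a B h k f α w ≤ quasiReversibility Ω T c a B h k f α v := by

  have hΩo := hΩ.isOpen
  have hΩb := hΩ.isBounded
  have hQ := isOpen_cylinder (T := T) hΩo
  obtain ⟨M, hM⟩ := hh_bdd
  have hh := memLp_top_iteratedDeriv_two (T := T) hΩo (fun t ht => (hh_space t ht).continuous)
    (fun x => (hh_time x).of_le (by norm_num)) hM
  obtain ⟨A, hA⟩ := isJetOperator_volterraOp hΩo hΩb hc.continuous ha.continuous hB.continuous hh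
    hk hk_ne
  have hF := memLp_volterraRhs hΩo hΩb hT ha.continuous hB.continuous (hf.mono (by omega)) hh hk
    hk_ne hk_zero
  -- The functional in terms of jets. The value is `ENNReal.ofReal` of a real number, which gives
  -- finiteness and turns comparisons in `[0, ∞]` into real ones.
  have hJ : ∀ (w : SpaceTimeL2 Ω T) (y : JetSpace (d + 1) 3 (cylinder Ω T)),
      (∀ β : multiIndices (d + 1) 3, y β =ᵐ[volume.restrict (cylinder Ω T)]
        weakDeriv (spaceTimeFrame d) β (cylinder Ω T) w) →
      quasiReversibility Ω T c a B h k f α w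
        = ENNReal.ofReal (‖A y - hF.toLp _‖ ^ 2 + α * ‖y‖ ^ 2) := by
    intro w y hy
    rw [quasiReversibility, hkNormSq_eq_norm_jet_sq hy, ENNReal.ofReal_add (by positivity)
      (by positivity), ENNReal.ofReal_mul hα.le, ENNReal.ofReal_pow (norm_nonneg (A y - _)),
      ofReal_norm, Lp.enorm_def]
    congr 2
    refine eLpNorm_congr_ae ?_
    filter_upwards [Lp.coeFn_sub (A y) (hF.toLp _), hA w y hy, hF.coeFn_toLp] with p h₁ h₂ h₃
    rw [h₁, Pi.sub_apply, h₂, h₃]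
  have hmem : ∀ w ∈ constraintSet Ω T Ψ ζ ξ,
      MemHk (spaceTimeFrame d) 3 (cylinder Ω T) w := fun _ hw => hw.1
  have hjet : ∀ w ∈ constraintSet Ω T Ψ ζ ξ, ∃ y : JetSpace (d + 1) 3 (cylinder Ω T),
      (∀ β : multiIndices (d + 1) 3, y β =ᵐ[volume.restrict (cylinder Ω T)]
        weakDeriv (spaceTimeFrame d) β (cylinder Ω T) w) := fun w hw => exists_jet (hmem w hw)
  refine ⟨fun w hw => ?_, ?_⟩
  · obtain ⟨y, hy⟩ := hjet w hw
    rw [hJ w y hy]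
    exact ENNReal.ofReal_lt_top
  obtain ⟨w₀, hw₀⟩ := hK
  obtain ⟨y₀, hy₀⟩ := hjet w₀ hw₀
  obtain ⟨y, ⟨⟨w, hw, hyw⟩, hmin⟩, huniq⟩ := exists_unique_tikhonov_minimizer A (hF.toLp _) hα
    (S := jetSet (spaceTimeFrame d) 3 (cylinder Ω T) (constraintSet Ω T Ψ ζ ξ))
    ⟨y₀, w₀, hw₀, hy₀⟩
    (isClosed_jetSet hQ hmem fun _ _ => mem_constraintSet_of_tendsto)
    (convex_jetSet hQ hmem (convex_constraintSet hΩo))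
  refine ⟨w, ⟨hw, fun v hv => ?_⟩, fun v ⟨hv, hvmin⟩ => ?_⟩
  · obtain ⟨z, hz⟩ := hjet v hv
    rw [hJ w y hyw, hJ v z hz]
    exact ENNReal.ofReal_le_ofReal (hmin z ⟨v, hv, hz⟩)
  · obtain ⟨z, hz⟩ := hjet v hv
    -- The competitor `v` does at least as well as `w`, whose jet is minimal, so the jet of `v` is
    -- also minimal and must equal `y`.
    have hzy : z = y := by
      refine huniq z ⟨⟨v, hv, hz⟩, fun z' hz' => ?_⟩
      have h₁ := hvmin w hw
      rw [hJ w y hyw, hJ v z hz, ENNReal.ofReal_le_ofReal_iff (by positivity)] at h₁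
      exact h₁.trans (hmin z' hz')
    rw [← jet_zeroIndex hQ hz, ← jet_zeroIndex hQ hyw, hzy]
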